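/- Fix $m\ge 1$ types of parentheses. For a string $S$, let $\mu(S)$ be $S$ with the types removed, and let $e_0(S)$ be the least $\ell$ such that $(^k\mu(S))^\ell$ is balanced for some $k$; the excess parentheses of a substring $S$ are those whose partner (found by ordinary parenthesis matching that ignores types) does not lie in $S$, so $e_0(S)$ is the number of excess opening parentheses. Let $T$ be a string of length $n$, let $1\le x\le n$, and let $S_1,S_2$ be substrings of $T$, at known positions, of length at most $x$. A matching between a set of excess opening parentheses of $S_1$ and a set of excess closing parentheses of $S_2$ is called admissible if it is perfect, nested (the $r$-th element from the right of the first set is matched with the $r$-th element from the left of the second), and any two matched parentheses $T[i],T[j]$ have the same type and $|j-i+1|$ is even. For $\varepsilon>0$ we say that $S_1,S_2$ $\varepsilon$-match if, after removing at most $7\varepsilon x$ leftmost and at most $5\varepsilon x$ rightmost excess opening parentheses of $S_1$, the remaining ones have an admissible matching with a contiguous range of the excess closing parentheses of $S_2$. Theorem. For every constant $0<\delta\le 1/2$ there is a randomized adaptive query algorithm which, given $m,n,x,\varepsilon$, the positions of $S_1,S_2$, and query access to $T$, - accepts with probability at least $1-1/n^2$ if $S_1,S_2$ $\varepsilon$-match;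 - rejects with probability at least $1-1/n^2$ if at most $e_0(S_1)-30\varepsilon x$ excess opening parentheses of $S_1$ can be matched in $S_2$, that is, if every admissible matching between a subsequence of the excess opening parentheses of $S_1$ and a subsequence of the excess closing parentheses of $S_2$ has size at most $e_0(S_1)-30\varepsilon x$. In the worst case it makes $\tilde O\bigl(\varepsilon^{\,4-4(2\delta)^{1/\log_2(3/4)}}\,x^{1/2+\delta}\bigr)$ queries: there are constants $C,p$ depending only on $\delta$ such that the number of queries is always at most $C(1+\log n)^p\,\varepsilon^{\,4-4(2\delta)^{1/\log_2(3/4)}}\,x^{1/2+\delta}$. -/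

import Mathlib

namespace SubstringMatching

/-- Parentheses of `m` types: `(DyckStep.U, c)` is an opening parenthesis of type `c` and
`(DyckStep.D, c)` is a closing parenthesis of type `c`. -/
abbrev Paren (m : ℕ) : Type := DyckStep × Fin m

/-- Strings of length `n` over the parentheses of `m` types. -/
abbrev Str (m n : ℕ) : Type := Fin n → Paren m

/-! ### Excess parentheses -/

/-- Membership in the Dyck language `D₁` of balanced strings with one type of parentheses. -/
def IsD1 (w : List DyckStep) : Prop := ∃ p : DyckWord, p.toList = w

/-- `μ(S)`: the string `S` with the types of the parentheses removed. -/
def mu {m : ℕ} (S : List (Paren m)) : List DyckStep := S.map Prod.fst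

/-- The substring `T[a], T[a+1], …, T[b-1]` of `T` (positions are numbered from `0`). -/
def slice {m n : ℕ} (T : Str m n) (a b : ℕ) : List (Paren m) := ((List.ofFn T).take b).drop a

/-- The location of a (possibly empty) substring in a string of length `n`: it consists of the
positions `i` with `lo ≤ i < hi`. -/
structure Window (n : ℕ) where
  lo : ℕ
  hi : ℕ
  lo_le_hi : lo ≤ hi
  hi_le : hi ≤ n

/-- The length of the substring. -/
def Window.length {n : ℕ} (S : Window n) : ℕ := S.hi - S.lo

/-- The substring itself, as a list of parentheses. -/
def Window.str {m n : ℕ} (S : Window n) (T : Str m n) : List (Paren m) := slice T S.lo S.hi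

/-- `e₀(S)`, the excess number of opening parentheses of a string `S`: the smallest `ℓ` such that
`(ᵏ μ(S) )ˡ` (with `l = ℓ`) is in `D₁` for some `k`.  As `k - ℓ` is determined by `S`,
the least `ℓ` and the least `k` are attained together. -/
noncomputable def e0 {m : ℕ} (S : List (Paren m)) : ℕ :=
  sInf {l : ℕ | ∃ k : ℕ,
    IsD1 (List.replicate k DyckStep.U ++ mu S ++ List.replicate l DyckStep.D)}

/-- Types being ignored, the opening parenthesis at `i` and the closing parenthesis at `j` are
partners: `i < j` and the string strictly between them is balanced. -/
def Partners {m n : ℕ} (T : Str m n) (i j : Fin n) : Prop :=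
  i < j ∧ (T i).1 = DyckStep.U ∧ (T j).1 = DyckStep.D ∧ IsD1 (mu (slice T (i + 1) j))

open Classical in
/-- The (positions of the) excess opening parentheses of a substring: the opening parentheses
that have no partner inside the substring. -/
noncomputable def excessOpen {m n : ℕ} (T : Str m n) (S : Window n) : Finset (Fin n) :=
  Finset.univ.filter fun i => S.lo ≤ (i : ℕ) ∧ (i : ℕ) < S.hi ∧ (T i).1 = DyckStep.U ∧
    ∀ j : Fin n, (j : ℕ) < S.hi → ¬ Partners T i j

open Classical in
/-- The (positions of the) excess closing parentheses of a substring: the closing parentheses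
that have no partner inside the substring. -/
noncomputable def excessClose {m n : ℕ} (T : Str m n) (S : Window n) : Finset (Fin n) :=
  Finset.univ.filter fun j => S.lo ≤ (j : ℕ) ∧ (j : ℕ) < S.hi ∧ (T j).1 = DyckStep.D ∧
    ∀ i : Fin n, S.lo ≤ (i : ℕ) → ¬ Partners T i j

/-! ### Matching the excess parentheses of two substrings -/

/-- There is a perfect matching `φ` between the positions in `O` and the positions in `C` which is
nested (the rightmost position in `O` is matched with the leftmost one in `C`, and so on), such
that matched parentheses `T[i], T[j]` have the same type and `|j - i + 1|` is even. -/
def NestedMatching {m n : ℕ} (T : Str m n) (O C : Finset (Fin n)) : Prop :=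
  ∃ φ : Fin n → Fin n, Set.BijOn φ O C ∧ StrictAntiOn φ O ∧
    ∀ i ∈ O, (T i).2 = (T (φ i)).2 ∧ Even |((φ i : ℕ) : ℤ) - ((i : ℕ) : ℤ) + 1|

/-- The opening parentheses at the positions in `O` can be matched with a contiguous range (those
at positions in some `[c, d)`) of the excess closing parentheses of `S₂`. -/
def MatchedInRange {m n : ℕ} (T : Str m n) (O : Finset (Fin n)) (S₂ : Window n) : Prop :=
  ∃ c d : ℕ, NestedMatching T O
    ((excessClose T S₂).filter fun j : Fin n => c ≤ (j : ℕ) ∧ (j : ℕ) < d)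

/-- `S₁, S₂` `ε`-match with respect to the maximal length `x`: all but at most `7εx` leftmost and
at most `5εx` rightmost excess opening parentheses of `S₁` can be matched with a contiguous range
of excess closing parentheses of `S₂`. -/
def EpsMatch {m n : ℕ} (T : Str m n) (ε : ℝ) (x : ℕ) (S₁ S₂ : Window n) : Prop :=
  ∃ p q : ℕ,
    (((excessOpen T S₁).filter fun i : Fin n => (i : ℕ) < p).card : ℝ) ≤ 7 * ε * x ∧
    (((excessOpen T S₁).filter fun i : Fin n => q ≤ (i : ℕ)).card : ℝ) ≤ 5 * ε * x ∧
    MatchedInRange T ((excessOpen T S₁).filter fun i : Fin n => p ≤ (i : ℕ) ∧ (i : ℕ) < q) S₂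

/-- At most `e₀(S₁) - 30εx` excess opening parentheses of `S₁` can be matched in `S₂`: no
subsequence of more than `e₀(S₁) - 30εx` excess opening parentheses of `S₁` can be matched with a
subsequence of the excess closing parentheses of `S₂`. -/
def FarFromMatch {m n : ℕ} (T : Str m n) (ε : ℝ) (x : ℕ) (S₁ S₂ : Window n) : Prop :=
  ∀ O C : Finset (Fin n), O ⊆ excessOpen T S₁ → C ⊆ excessClose T S₂ → NestedMatching T O C →
    (O.card : ℝ) ≤ (e0 (S₁.str T) : ℝ) - 30 * ε * x

/-! ### Randomized query algorithms -/

/-- Deterministic adaptive algorithms with query access to a string `T : Str m n`. -/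
inductive DecisionTree (m n : ℕ) : Type
  | answer (accept : Bool) : DecisionTree m n
  | query (i : Fin n) (next : Paren m → DecisionTree m n) : DecisionTree m n

/-- The answer on the input `T` (`true` means that `T` is accepted). -/
def DecisionTree.eval {m n : ℕ} : DecisionTree m n → Str m n → Bool
  | .answer r, _ => r
  | .query i next, T => (next (T i)).eval T

/-- The number of queries made on the input `T`. -/
def DecisionTree.numQueries {m n : ℕ} : DecisionTree m n → Str m n → ℕ
  | .answer _, _ => 0
  | .query i next, T => (next (T i)).numQueries T + 1

/-- A randomized query algorithm is a probability distribution over deterministic ones. -/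
abbrev RandomizedAlgorithm (m n : ℕ) : Type := PMF (DecisionTree m n)

/-- The probability that the algorithm gives the answer `r` on the input `T`. -/
noncomputable def probAnswer {m n : ℕ} (A : RandomizedAlgorithm m n) (T : Str m n) (r : Bool) :
    ℝ :=
  ((A.map fun t => t.eval T) r).toReal

/-- The worst-case number of queries, over all inputs and all outcomes of the random choices, is
at most `B`. -/
def QueryComplexityLE {m n : ℕ} (A : RandomizedAlgorithm m n) (B : ℝ) : Prop :=
  ∀ t ∈ A.support, ∀ T : Str m n, (t.numQueries T : ℝ) ≤ B

/-- `A` solves Substring `ε`-matching`(x)` for the substrings at `S₁, S₂` of the input string with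
error at most `η`. -/
def SolvesSubstringMatching {m n : ℕ} (A : RandomizedAlgorithm m n) (ε : ℝ) (x : ℕ)
    (S₁ S₂ : Window n) (η : ℝ) : Prop :=
  ∀ T : Str m n,
    (EpsMatch T ε x S₁ S₂ → 1 - η ≤ probAnswer A T true) ∧
    (FarFromMatch T ε x S₁ S₂ → 1 - η ≤ probAnswer A T false)

end SubstringMatching

/-! Types ignored, an excess opening parenthesis of a window is determined by the height where it
starts and an excess closing one by the height where it ends. The heights of each kind are
consecutive integers, so an admissible matching onto a contiguous range is a shift `h ↦ h + s` of an
interval `[α, β)` of heights (`FullMatch`, `exists_fullMatch`), while admissible matchings of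
subsequences correspond to chains of pairs of heights (`HasChain`).

The algorithm is non-adaptive: it reads random positions and accepts iff some string `T'` that fits
the answers, and for which the random choices are good, `ε`-matches. If `T` itself `ε`-matches and
the choices are good for it, `T` is a witness. Conversely, if the choices are good for `T` and `T'`
and the two agree on the queries, every full matching of `T'` gives a chain in `T` that misses at
most `εx` heights (`Transfer`), so `T` is not far from matching (`Transfer.not_far`). Goodness
concerns one string at a time, hence no union bound over `T'` is needed.

Such samplers are built recursively (`HasSampler.step`). Both windows are cut into `g²` blocks of
length `y`, about `x / g²`. For a fixed shift, the heights in `[α, β)` split into cells indexed by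
pairs of blocks, and the nonempty cells form a staircase of at most `2g²` pairs. Sampled positions
estimate all heights, so the cells of `T` and `T'` nearly coincide. Call a pair bad if its cell has
no large chain in `T`. Each row and column of cells has weight at most `y`, so bad pairs of weight
`W` contain a matching of at least `W / (2y)` pairs, and choosing `g` random blocks on each side
catches both ends of one of them with probability of order `ε`, by a birthday argument
(`prob_not_hits_le`); about `Λ / ε` trials make this nearly certain. The query set of a block
depends on that block and the random seed only, not on its partner, so `2g` query sets test `g²`
pairs. A tested pair whose cell is fully matched in `T'` cannot be bad. Hence the bad pairs are
light and the chains of the others combine.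

Up to logarithms one step costs `g⁴ / ε²` for the heights plus `g / ε` times the cost at length `x /
g²` and accuracy `ε / 1000`. Taking `g` about `x^(1/8)` turns the exponent `1/2 + δ` into `1/2 +
3δ/4`, and the exponent `f` of `1/ε` may be replaced by `2f + 4`; `epsExponent` satisfies this
recurrence. Reading everything gives `δ = 1/2`, one tuned step reaches `[3/8, 1/2]`, and a number of
further steps depending only on `δ` suffices. -/

namespace SubstringMatching

/-! ### Heights -/

/-- The contribution of the parenthesis at position `p` to the height. -/
def stepAt {m n : ℕ} (T : Str m n) (p : ℕ) : ℤ :=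
  if h : p < n then (if (T ⟨p, h⟩).1 = DyckStep.U then 1 else -1) else 0

/-- The number of opening minus the number of closing parentheses before position `k`. -/
def height {m n : ℕ} (T : Str m n) (k : ℕ) : ℤ := ∑ p ∈ Finset.range k, stepAt T p

lemma height_succ {m n : ℕ} (T : Str m n) (k : ℕ) : height T (k + 1) = height T k + stepAt T k :=
  Finset.sum_range_succ _ _

lemma stepAt_val {m n : ℕ} (T : Str m n) (i : Fin n) :
    stepAt T i = if (T i).1 = DyckStep.U then 1 else -1 := by
  simp [stepAt]

lemma abs_stepAt_le {m n : ℕ} (T : Str m n) (p : ℕ) : |stepAt T p| ≤ 1 := by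
  unfold stepAt
  split_ifs <;> simp

lemma height_step_bounds {m n : ℕ} (T : Str m n) (k : ℕ) :
    height T k - 1 ≤ height T (k + 1) ∧ height T (k + 1) ≤ height T k + 1 := by
  have h := abs_le.mp (abs_stepAt_le T k)
  rw [height_succ]
  constructor <;> linarith [h.1, h.2]

lemma height_add_bounds {m n : ℕ} (T : Str m n) (k l : ℕ) :
    height T k - l ≤ height T (k + l) ∧ height T (k + l) ≤ height T k + l := by
  induction l with
  | zero => simp
  | succ l ih =>
    have h := height_step_bounds T (k + l)
    rw [← add_assoc]
    push_cast
    constructor <;> linarith [h.1, h.2, ih.1, ih.2]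

/-- The least height between the positions `a` and `b`. -/
noncomputable def minOn {m n : ℕ} (T : Str m n) (a b : ℕ) : ℤ := sInf (height T '' Set.Icc a b)

lemma minOn_le {m n : ℕ} (T : Str m n) {a b k : ℕ} (h1 : a ≤ k) (h2 : k ≤ b) :
    minOn T a b ≤ height T k :=
  csInf_le ((Set.finite_Icc a b).image _).bddBelow ⟨k, ⟨h1, h2⟩, rfl⟩

lemma minOn_attained {m n : ℕ} (T : Str m n) {a b : ℕ} (h : a ≤ b) :
    ∃ k, a ≤ k ∧ k ≤ b ∧ height T k = minOn T a b := by
  have hne : (height T '' Set.Icc a b).Nonempty := ⟨_, a, ⟨le_rfl, h⟩, rfl⟩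
  obtain ⟨k, hk, e⟩ := Int.csInf_mem hne ((Set.finite_Icc a b).image _).bddBelow
  exact ⟨k, hk.1, hk.2, e⟩

lemma minOn_mono {m n : ℕ} (T : Str m n) {a b a' b' : ℕ} (h1 : a ≤ a') (h2 : a' ≤ b')
    (h3 : b' ≤ b) : minOn T a b ≤ minOn T a' b' := by
  obtain ⟨k, hk1, hk2, e⟩ := minOn_attained T h2
  rw [← e]
  exact minOn_le T (by omega) (by omega)

lemma minOn_close {m n : ℕ} {T T' : Str m n} {a b l : ℕ} {E : ℤ} (h : a ≤ b)
    (hE : ∀ k, a ≤ k → k ≤ b →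
      |(height T k - height T l) - (height T' k - height T' l)| ≤ E) :
    |(minOn T a b - height T l) - (minOn T' a b - height T' l)| ≤ E := by
  obtain ⟨k, hk1, hk2, e⟩ := minOn_attained T h
  obtain ⟨k', hk1', hk2', e'⟩ := minOn_attained T' h
  have h1 := abs_le.mp (hE k hk1 hk2)
  have h2 := abs_le.mp (hE k' hk1' hk2')
  have h3 := minOn_le T hk1' hk2'
  have h4 := minOn_le T' hk1 hk2
  rw [abs_le]
  constructor <;> linarith [h1.1, h1.2, h2.1, h2.2]

/-! ### Excess parentheses by height -/

/-- The position `i` carries the excess opening parenthesis of the window `I` that starts at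
height `h` above the beginning of `I`. -/
def OpenAt {m n : ℕ} (T : Str m n) (I : Window n) (h : ℤ) (i : Fin n) : Prop :=
  I.lo ≤ i ∧ (i : ℕ) < I.hi ∧ height T i - height T I.lo = h ∧
    ∀ k : ℕ, (i : ℕ) < k → k ≤ I.hi → height T i < height T k

/-- The position `j` carries the excess closing parenthesis of the window `J` that ends at
height `h` above the beginning of `J`. -/
def CloseAt {m n : ℕ} (T : Str m n) (J : Window n) (h : ℤ) (j : Fin n) : Prop :=
  J.lo ≤ j ∧ (j : ℕ) < J.hi ∧ height T (j + 1) - height T J.lo = h ∧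
    ∀ k : ℕ, J.lo ≤ k → k ≤ j → height T (j + 1) < height T k

/-- The parentheses at `i` and `j` may be matched. -/
def Compatible {m n : ℕ} (T : Str m n) (i j : Fin n) : Prop :=
  (T i).2 = (T j).2 ∧ Even |((j : ℕ) : ℤ) - ((i : ℕ) : ℤ) + 1|

/-- The excess opening parenthesis of `I` at height `h` may be matched with the excess closing
parenthesis of `J` at height `h'`. -/
def HeightRel {m n : ℕ} (T : Str m n) (I J : Window n) (h h' : ℤ) : Prop :=
  ∃ i j, OpenAt T I h i ∧ CloseAt T J h' j ∧ Compatible T i j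

/-- A set of pairs in which the two coordinates are ordered in the same way. -/
def IsStrictChain (S : Finset (ℤ × ℤ)) : Prop :=
  ∀ p ∈ S, ∀ q ∈ S, (p.1 < q.1 ↔ p.2 < q.2)

/-- `r` contains a chain with at least `l` elements in the square `[α, β) × [α + s, β + s)`. -/
def HasChain (r : ℤ → ℤ → Prop) (α β s l : ℤ) : Prop :=
  ∃ S : Finset (ℤ × ℤ), IsStrictChain S ∧
    (∀ p ∈ S, r p.1 p.2 ∧ (α ≤ p.1 ∧ p.1 < β) ∧ (α + s ≤ p.2 ∧ p.2 < β + s)) ∧ l ≤ S.card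

lemma HasChain.of_nonpos {r : ℤ → ℤ → Prop} {α β s l : ℤ} (h : l ≤ 0) : HasChain r α β s l :=
  ⟨∅, by simp [IsStrictChain], by simp, by simpa using h⟩

lemma IsStrictChain.injOn_fst {S : Finset (ℤ × ℤ)} (hS : IsStrictChain S) :
    Set.InjOn Prod.fst (S : Set (ℤ × ℤ)) := by
  intro p hp q hq h
  have h1 := hS p hp q hq
  have h2 := hS q hq p hp
  ext
  · exact h
  · omega

lemma IsStrictChain.injOn_snd {S : Finset (ℤ × ℤ)} (hS : IsStrictChain S) :
    Set.InjOn Prod.snd (S : Set (ℤ × ℤ)) := by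
  intro p hp q hq h
  have h1 := hS p hp q hq
  have h2 := hS q hq p hp
  ext
  · omega
  · exact h

/-- By injectivity of `f`, the lost points inject into the `E` integers at either end of `[a, b)`.
-/
lemma card_filter_not_Ico_le {S : Finset (ℤ × ℤ)} {f : ℤ × ℤ → ℤ} (hf : Set.InjOn f S)
    {a b a' b' : ℤ} {E : ℤ} (hE : 0 ≤ E) (ha : a' ≤ a + E) (hb : b - E ≤ b')
    (h : ∀ p ∈ S, a ≤ f p ∧ f p < b) :
    ((S.filter fun p => ¬ (a' ≤ f p ∧ f p < b')).card : ℤ) ≤ 2 * E := by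
  have h1 : (S.filter fun p => ¬ (a' ≤ f p ∧ f p < b')).card
      ≤ (Finset.Ico a (a + E) ∪ Finset.Ico (b - E) b).card := by
    refine Finset.card_le_card_of_injOn f ?_ (hf.mono fun p hp => (Finset.mem_filter.mp hp).1)
    intro p hp
    have hp := Finset.mem_filter.mp (Finset.mem_coe.mp hp)
    have := h p hp.1
    simp only [Finset.coe_union, Finset.coe_Ico, Set.mem_union, Set.mem_Ico]
    omega
  have h2 := Finset.card_union_le (Finset.Ico a (a + E)) (Finset.Ico (b - E) b)
  simp only [Int.card_Ico] at h2
  omega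

/-- Passing to a slightly different square costs little. -/
lemma HasChain.change {r : ℤ → ℤ → Prop} {α β s l α' β' s' E : ℤ} (hE : 0 ≤ E)
    (h : HasChain r α β s l) (h1 : α' ≤ α + E) (h2 : β - E ≤ β') (h3 : α' + s' ≤ α + s + E)
    (h4 : β + s - E ≤ β' + s') : HasChain r α' β' s' (l - 4 * E) := by
  obtain ⟨S, hS, hr, hl⟩ := h
  have e1 := card_filter_not_Ico_le hS.injOn_fst hE h1 h2 (fun p hp => (hr p hp).2.1)
  have e2 := card_filter_not_Ico_le hS.injOn_snd hE h3 h4 (fun p hp => (hr p hp).2.2)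
  -- Pairs outside the new square are dropped; each coordinate accounts for at most `2 * E` of them.
  refine ⟨S.filter fun p => (α' ≤ p.1 ∧ p.1 < β') ∧ (α' + s' ≤ p.2 ∧ p.2 < β' + s'), ?_, ?_, ?_⟩
  · intro p hp q hq
    exact hS p (Finset.mem_filter.mp hp).1 q (Finset.mem_filter.mp hq).1
  · intro p hp
    have hp := Finset.mem_filter.mp hp
    exact ⟨(hr p hp.1).1, hp.2⟩
  · have h5 := Finset.card_filter_add_card_filter_not (s := S)
      (fun p => (α' ≤ p.1 ∧ p.1 < β') ∧ (α' + s' ≤ p.2 ∧ p.2 < β' + s'))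
    have h6 : (S.filter fun p =>
        ¬ ((α' ≤ p.1 ∧ p.1 < β') ∧ (α' + s' ≤ p.2 ∧ p.2 < β' + s'))).card ≤
        ((S.filter fun p => ¬ (α' ≤ p.1 ∧ p.1 < β')) ∪
          (S.filter fun p => ¬ (α' + s' ≤ p.2 ∧ p.2 < β' + s'))).card := by
      apply Finset.card_le_card
      intro p hp
      simp only [Finset.mem_union, Finset.mem_filter] at hp ⊢
      tauto
    have h7 := Finset.card_union_le (S.filter fun p => ¬ (α' ≤ p.1 ∧ p.1 < β'))
      (S.filter fun p => ¬ (α' + s' ≤ p.2 ∧ p.2 < β' + s'))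
    omega

/-- All excess opening parentheses of `I` at heights in `[α, β)` exist and may be matched with the
excess closing parentheses of `J` at the heights shifted by `s`. -/
def FullMatch {m n : ℕ} (T : Str m n) (I J : Window n) (α β s : ℤ) : Prop :=
  ∀ h, α ≤ h → h < β → HeightRel T I J h (h + s)

/-- The heights of `T` and `T'` in the window `I` differ by at most `E`. -/
def HeightsClose {m n : ℕ} (T T' : Str m n) (I : Window n) (E : ℤ) : Prop :=
  ∀ k, I.lo ≤ k → k ≤ I.hi →
    |(height T k - height T I.lo) - (height T' k - height T' I.lo)| ≤ E

/-- Full matchings of `T'` give large chains in `T`. -/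
def Transfer {m n : ℕ} (T T' : Str m n) (I J : Window n) (d : ℤ) : Prop :=
  HeightsClose T T' I d ∧
    ∀ α β s, FullMatch T' I J α β s → HasChain (HeightRel T I J) α β s (β - α - d)

/-! ### Blocks -/

/-- The beginning of the `a`-th block of length `y` of a window. -/
def Window.cut {n : ℕ} (I : Window n) (y a : ℕ) : ℕ := min (I.lo + a * y) I.hi

lemma Window.cut_mono {n : ℕ} (I : Window n) (y : ℕ) : Monotone (I.cut y) := by
  intro a b h
  have := Nat.mul_le_mul_right y h
  unfold Window.cut
  omega

lemma Window.lo_le_cut {n : ℕ} (I : Window n) (y a : ℕ) : I.lo ≤ I.cut y a := by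
  have := I.lo_le_hi
  unfold Window.cut
  omega

lemma Window.cut_le_hi {n : ℕ} (I : Window n) (y a : ℕ) : I.cut y a ≤ I.hi := by
  unfold Window.cut
  omega

lemma Window.cut_zero {n : ℕ} (I : Window n) (y : ℕ) : I.cut y 0 = I.lo := by
  have := I.lo_le_hi
  unfold Window.cut
  omega

lemma Window.cut_last {n : ℕ} (I : Window n) {y N : ℕ} (h : I.length ≤ N * y) :
    I.cut y N = I.hi := by
  have := I.lo_le_hi
  unfold Window.length at h
  unfold Window.cut
  omega

lemma Window.cut_succ_le {n : ℕ} (I : Window n) (y a : ℕ) : I.cut y (a + 1) ≤ I.cut y a + y := by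
  unfold Window.cut
  rw [Nat.succ_mul]
  omega

/-- The `a`-th block of length `y` of a window. -/
def Window.block {n : ℕ} (I : Window n) (y a : ℕ) : Window n where
  lo := I.cut y a
  hi := I.cut y (a + 1)
  lo_le_hi := I.cut_mono y (Nat.le_succ a)
  hi_le := (I.cut_le_hi y _).trans I.hi_le

lemma Window.block_length_le {n : ℕ} (I : Window n) (y a : ℕ) : (I.block y a).length ≤ y := by
  have := I.cut_succ_le y a
  simp only [Window.length, Window.block]
  omega

/-- The least height after the beginning of the `a`-th block. -/
noncomputable def futMin {m n : ℕ} (T : Str m n) (I : Window n) (y a : ℕ) : ℤ :=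
  minOn T (I.cut y a) I.hi - height T I.lo

/-- The least height before the beginning of the `b`-th block. -/
noncomputable def pastMin {m n : ℕ} (T : Str m n) (J : Window n) (y b : ℕ) : ℤ :=
  minOn T J.lo (J.cut y b) - height T J.lo

/-- The height of the beginning of the `a`-th block. -/
def baseHeight {m n : ℕ} (T : Str m n) (I : Window n) (y a : ℕ) : ℤ :=
  height T (I.cut y a) - height T I.lo

lemma futMin_mono {m n : ℕ} (T : Str m n) (I : Window n) (y : ℕ) : Monotone (futMin T I y) := by
  intro a b h
  have := minOn_mono T (I.cut_mono y h) (I.cut_le_hi y b) le_rfl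
  unfold futMin
  omega

lemma pastMin_anti {m n : ℕ} (T : Str m n) (J : Window n) (y : ℕ) : Antitone (pastMin T J y) := by
  intro a b h
  have := minOn_mono T le_rfl (J.lo_le_cut y a) (J.cut_mono y h)
  unfold pastMin
  omega

/-- If the minimum is attained inside the `a`-th block, the next block begins at most `y` positions
later, hence at most `y` higher. This bounds the weight of a row of cells. -/
lemma futMin_succ_le {m n : ℕ} (T : Str m n) (I : Window n) (y a : ℕ) :
    futMin T I y (a + 1) ≤ futMin T I y a + y := by
  obtain ⟨k, h1, h2, e⟩ := minOn_attained T (I.cut_le_hi y a)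
  unfold futMin
  by_cases hk : I.cut y (a + 1) ≤ k
  · have := minOn_le T hk h2
    omega
  · have h3 := minOn_le T le_rfl (I.cut_le_hi y (a + 1))
    have h4 := I.cut_succ_le y a
    have h5 := height_add_bounds T k (I.cut y (a + 1) - k)
    rw [Nat.add_sub_cancel' (by omega)] at h5
    omega

lemma pastMin_le_succ {m n : ℕ} (T : Str m n) (J : Window n) (y b : ℕ) :
    pastMin T J y b ≤ pastMin T J y (b + 1) + y := by
  obtain ⟨k, h1, h2, e⟩ := minOn_attained T (J.lo_le_cut y (b + 1))
  unfold pastMin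
  by_cases hk : k ≤ J.cut y b
  · have := minOn_le T h1 hk
    omega
  · have h3 := minOn_le T (J.lo_le_cut y b) le_rfl
    have h4 := J.cut_succ_le y b
    have h5 := height_add_bounds T (J.cut y b) (k - J.cut y b)
    rw [Nat.add_sub_cancel' (by omega)] at h5
    omega

/-! ### Excess parentheses of a window and of its blocks -/

lemma OpenAt.of_block {m n : ℕ} {T : Str m n} {I : Window n} {y a : ℕ} {h : ℤ} {i : Fin n}
    (hi : OpenAt T (I.block y a) (h - baseHeight T I y a) i) (hf : h < futMin T I y (a + 1)) :
    OpenAt T I h i := by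
  obtain ⟨h1, h2, h3, h4⟩ := hi
  simp only [Window.block, baseHeight, futMin] at *
  refine ⟨(I.lo_le_cut y a).trans h1, h2.trans_le (I.cut_le_hi y _), by omega, fun k hk hk' => ?_⟩
  by_cases hc : k ≤ I.cut y (a + 1)
  · exact h4 k hk hc
  · have := minOn_le T (show I.cut y (a + 1) ≤ k by omega) hk'
    omega

/-- An excess opening parenthesis lies below everything after it. So it is not before the block,
where a later point would reach height `futMin T I y a`, and not after it, where it would be at
least `futMin T I y (a + 1)` high. -/
lemma OpenAt.to_block {m n : ℕ} {T : Str m n} {I : Window n} {y a : ℕ} {h : ℤ} {i : Fin n}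
    (hi : OpenAt T I h i) (hf : futMin T I y a ≤ h) (hf' : h < futMin T I y (a + 1)) :
    OpenAt T (I.block y a) (h - baseHeight T I y a) i := by
  obtain ⟨h1, h2, h3, h4⟩ := hi
  simp only [Window.block, baseHeight, futMin] at *
  refine ⟨?_, ?_, by simp only; omega, fun k hk hk' => h4 k hk (hk'.trans (I.cut_le_hi y _))⟩
  · by_contra hc
    obtain ⟨k, hk1, hk2, e⟩ := minOn_attained T (I.cut_le_hi y a)
    have := h4 k (by simp only at hc; omega) hk2
    omega
  · by_contra hc
    have := minOn_le T (show I.cut y (a + 1) ≤ i by simpa using hc) h2.le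
    omega

lemma CloseAt.of_block {m n : ℕ} {T : Str m n} {J : Window n} {y b : ℕ} {h : ℤ} {j : Fin n}
    (hj : CloseAt T (J.block y b) (h - baseHeight T J y b) j) (hf : h < pastMin T J y b) :
    CloseAt T J h j := by
  obtain ⟨h1, h2, h3, h4⟩ := hj
  simp only [Window.block, baseHeight, pastMin] at *
  refine ⟨(J.lo_le_cut y b).trans h1, h2.trans_le (J.cut_le_hi y _), by omega, fun k hk hk' => ?_⟩
  by_cases hc : J.cut y b ≤ k
  · exact h4 k hc hk'
  · have := minOn_le T hk (show k ≤ J.cut y b by omega)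
    omega

lemma CloseAt.to_block {m n : ℕ} {T : Str m n} {J : Window n} {y b : ℕ} {h : ℤ} {j : Fin n}
    (hj : CloseAt T J h j) (hf : pastMin T J y (b + 1) ≤ h) (hf' : h < pastMin T J y b) :
    CloseAt T (J.block y b) (h - baseHeight T J y b) j := by
  obtain ⟨h1, h2, h3, h4⟩ := hj
  simp only [Window.block, baseHeight, pastMin] at *
  refine ⟨?_, ?_, by simp only; omega, fun k hk hk' => h4 k ((J.lo_le_cut y _).trans hk) hk'⟩
  · by_contra hc
    have := minOn_le T (show J.lo ≤ (j : ℕ) + 1 by omega) (show (j : ℕ) + 1 ≤ J.cut y b by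
      simp only at hc; omega)
    omega
  · by_contra hc
    obtain ⟨k, hk1, hk2, e⟩ := minOn_attained T (J.lo_le_cut y (b + 1))
    have := h4 k hk1 (by simp only at hc; omega)
    omega

lemma OpenAt.futMin_bounds {m n : ℕ} {T : Str m n} {I : Window n} {y N : ℕ} {h : ℤ} {i : Fin n}
    (hi : OpenAt T I h i) (hN : I.length ≤ N * y) :
    futMin T I y 0 ≤ h ∧ h < futMin T I y N := by
  obtain ⟨h1, h2, h3, h4⟩ := hi
  unfold futMin
  rw [I.cut_zero, I.cut_last hN]
  obtain ⟨k, hk1, hk2, e⟩ := minOn_attained T (le_refl I.hi)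
  have := minOn_le T h1 h2.le
  have := h4 k (by omega) hk2
  omega

lemma CloseAt.pastMin_bounds {m n : ℕ} {T : Str m n} {J : Window n} {y N : ℕ} {h : ℤ} {j : Fin n}
    (hj : CloseAt T J h j) (hN : J.length ≤ N * y) :
    pastMin T J y N ≤ h ∧ h < pastMin T J y 0 := by
  obtain ⟨h1, h2, h3, h4⟩ := hj
  unfold pastMin
  rw [J.cut_zero, J.cut_last hN]
  obtain ⟨k, hk1, hk2, e⟩ := minOn_attained T (le_refl J.lo)
  have := minOn_le T (show J.lo ≤ (j : ℕ) + 1 by omega) (show (j : ℕ) + 1 ≤ J.hi by omega)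
  have := h4 k hk1 (by omega)
  omega

/-- Heights in a block are measured from its beginning; `c` and `d` are the base heights of the two
blocks when this is applied. -/
lemma HasChain.shift {r r' : ℤ → ℤ → Prop} {α β s l c d : ℤ}
    (h : HasChain r' (α - c) (β - c) (s + c - d) l)
    (hr : ∀ h h', (α ≤ h ∧ h < β) → (α + s ≤ h' ∧ h' < β + s) → r' (h - c) (h' - d) → r h h') :
    HasChain r α β s l := by
  obtain ⟨S, hS, h1, h2⟩ := h
  have hinj : Function.Injective fun p : ℤ × ℤ => (p.1 + c, p.2 + d) := by
    intro p q hpq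
    simp only [Prod.mk.injEq, add_left_inj] at hpq
    exact Prod.ext hpq.1 hpq.2
  refine ⟨S.image fun p => (p.1 + c, p.2 + d), ?_, ?_, ?_⟩
  · intro p hp q hq
    obtain ⟨p', hp', rfl⟩ := Finset.mem_image.mp hp
    obtain ⟨q', hq', rfl⟩ := Finset.mem_image.mp hq
    simpa using hS p' hp' q' hq'
  · intro p hp
    obtain ⟨p', hp', rfl⟩ := Finset.mem_image.mp hp
    obtain ⟨h3, h4, h5⟩ := h1 p' hp'
    have h6 : α ≤ p'.1 + c ∧ p'.1 + c < β := by omega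
    have h7 : α + s ≤ p'.2 + d ∧ p'.2 + d < β + s := by omega
    exact ⟨hr _ _ h6 h7 (by simpa using h3), h6, h7⟩
  · rwa [Finset.card_image_of_injective _ hinj]

/-- The union of chains over disjoint intervals is a chain. -/
lemma HasChain.biUnion {ι : Type*} [DecidableEq ι] (P : Finset ι) {r : ℤ → ℤ → Prop}
    {A B w : ι → ℤ} {α β s : ℤ}
    (hdisj : ∀ p ∈ P, ∀ q ∈ P, p ≠ q → B p ≤ A q ∨ B q ≤ A p)
    (hsub : ∀ p ∈ P, α ≤ A p ∧ B p ≤ β) (h : ∀ p ∈ P, HasChain r (A p) (B p) s (w p)) :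
    HasChain r α β s (∑ p ∈ P, w p) := by
  have h' : ∀ p, ∃ S : Finset (ℤ × ℤ), p ∈ P → (IsStrictChain S ∧
      (∀ u ∈ S, r u.1 u.2 ∧ (A p ≤ u.1 ∧ u.1 < B p) ∧ (A p + s ≤ u.2 ∧ u.2 < B p + s)) ∧
        w p ≤ S.card) := by
    intro p
    by_cases hp : p ∈ P
    · obtain ⟨S, hS⟩ := h p hp
      exact ⟨S, fun _ => hS⟩
    · exact ⟨∅, fun hp' => absurd hp' hp⟩
  choose S hS using h'
  refine ⟨P.biUnion S, ?_, ?_, ?_⟩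
  · intro u hu v hv
    obtain ⟨p, hp, hu⟩ := Finset.mem_biUnion.mp hu
    obtain ⟨q, hq, hv⟩ := Finset.mem_biUnion.mp hv
    by_cases hpq : p = q
    · subst hpq
      exact (hS p hp).1 u hu v hv
    · have h1 := hdisj p hp q hq hpq
      have h2 := (hS p hp).2.1 u hu
      have h3 := (hS q hq).2.1 v hv
      omega
  · intro u hu
    obtain ⟨p, hp, hu⟩ := Finset.mem_biUnion.mp hu
    have h2 := (hS p hp).2.1 u hu
    have h3 := hsub p hp
    exact ⟨h2.1, by omega, by omega⟩
  · rw [Finset.card_biUnion]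
    · push_cast
      exact Finset.sum_le_sum fun p hp => (hS p hp).2.2
    · intro p hp q hq hpq
      rw [Function.onFun, Finset.disjoint_left]
      intro u hu hv
      have h1 := hdisj p hp q hq hpq
      have h2 := (hS p hp).2.1 u hu
      have h3 := (hS q hq).2.1 u hv
      omega

/-! ### Cells: the heights in `[α, β)` that belong to a given pair of blocks -/

section Cells

variable (f g : ℕ → ℤ) (α β s : ℤ)

/-- The lower end of a cell. -/
def cellLo (p : ℕ × ℕ) : ℤ := max α (max (f p.1) (g (p.2 + 1) - s))

/-- The upper end of a cell. -/
def cellHi (p : ℕ × ℕ) : ℤ := min β (min (f (p.1 + 1)) (g p.2 - s))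

/-- The size of a cell. -/
def cellSize (p : ℕ × ℕ) : ℕ := (cellHi f g β s p - cellLo f g α s p).toNat

variable {f g α β s}

/-- A height `h` in a cell fixes the row through the steps of `f`, and `h + s` fixes the column
through the steps of `g`. -/
lemma cell_disjoint (hf : Monotone f) (hg : Antitone g) {p q : ℕ × ℕ} (h : p ≠ q) :
    cellHi f g β s p ≤ cellLo f g α s q ∨ cellHi f g β s q ≤ cellLo f g α s p := by
  unfold cellHi cellLo
  rcases lt_trichotomy p.1 q.1 with h1 | h1 | h1
  · have := hf (Nat.succ_le_of_lt h1)
    simp only [Nat.succ_eq_add_one] at this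
    omega
  · rcases lt_trichotomy p.2 q.2 with h2 | h2 | h2
    · have := hg (Nat.succ_le_of_lt h2)
      simp only [Nat.succ_eq_add_one] at this
      omega
    · exact absurd (Prod.ext h1 h2) h
    · have := hg (Nat.succ_le_of_lt h2)
      simp only [Nat.succ_eq_add_one] at this
      omega
  · have := hf (Nat.succ_le_of_lt h1)
    simp only [Nat.succ_eq_add_one] at this
    omega

lemma sum_cellSize_le (hf : Monotone f) (hg : Antitone g) (P : Finset (ℕ × ℕ)) {A B : ℤ}
    (hA : ∀ p ∈ P, A ≤ cellLo f g α s p) (hB : ∀ p ∈ P, cellHi f g β s p ≤ B) :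
    ∑ p ∈ P, cellSize f g α β s p ≤ (B - A).toNat := by
  have h1 : (P.biUnion fun p => Finset.Ico (cellLo f g α s p) (cellHi f g β s p)).card
      = ∑ p ∈ P, cellSize f g α β s p := by
    rw [Finset.card_biUnion]
    · simp [cellSize]
    · intro p hp q hq hpq
      rw [Function.onFun, Finset.disjoint_left]
      intro u hu hv
      have := cell_disjoint (α := α) (β := β) (s := s) hf hg hpq
      simp only [Finset.mem_Ico] at hu hv
      omega
  rw [← h1, ← Int.card_Ico]
  apply Finset.card_le_card
  intro u hu
  obtain ⟨p, hp, hu⟩ := Finset.mem_biUnion.mp hu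
  have := hA p hp
  have := hB p hp
  simp only [Finset.mem_Ico] at hu ⊢
  omega

lemma exists_step_of_mono {f : ℕ → ℤ} {N : ℕ} {h : ℤ} (h0 : f 0 ≤ h) (h1 : h < f N) :
    ∃ a < N, f a ≤ h ∧ h < f (a + 1) := by
  induction N with
  | zero => omega
  | succ N ih =>
    by_cases hc : h < f N
    · obtain ⟨a, ha, h2⟩ := ih hc
      exact ⟨a, by omega, h2⟩
    · exact ⟨N, by omega, by omega, h1⟩

lemma le_sum_cellSize (f g : ℕ → ℤ) (α β s : ℤ) (N : ℕ) :
    min β (min (f N) (g 0 - s)) - max α (max (f 0) (g N - s)) ≤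
      ((∑ p ∈ Finset.range N ×ˢ Finset.range N, cellSize f g α β s p : ℕ) : ℤ) := by
  have h1 : (Finset.Ico (max α (max (f 0) (g N - s))) (min β (min (f N) (g 0 - s)))).card ≤
      ((Finset.range N ×ˢ Finset.range N).biUnion fun p =>
        Finset.Ico (cellLo f g α s p) (cellHi f g β s p)).card := by
    apply Finset.card_le_card
    intro h hh
    rw [Finset.mem_Ico] at hh
    obtain ⟨a, ha, ha1, ha2⟩ := exists_step_of_mono (f := f) (N := N) (h := h)
      (by omega) (by omega)
    -- Negation makes the steps of `g` increase but swaps the strict and weak ends of `g (b + 1) ≤ h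
    -- + s < g b`; the `- 1` swaps them back.
    obtain ⟨b, hb, hb1, hb2⟩ := exists_step_of_mono (f := fun b => - g b) (N := N)
      (h := - (h + s) - 1) (by omega) (by omega)
    refine Finset.mem_biUnion.mpr ⟨(a, b), by simp [ha, hb], ?_⟩
    rw [Finset.mem_Ico]
    unfold cellLo cellHi
    simp only
    omega
  have h2 := h1.trans Finset.card_biUnion_le
  simp only [Int.card_Ico] at h2
  have h3 : ∀ p, cellSize f g α β s p = (cellHi f g β s p - cellLo f g α s p).toNat :=
    fun _ => rfl
  simp only [h3]
  omega

/-- Heights grow with the row and fall with the column, so of two nonempty cells neither exceeds the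
other strictly in both coordinates. On such a staircase `p.1 + (N - p.2)` is injective. -/
lemma card_nonempty_cells_le (hf : Monotone f) (hg : Antitone g) (N : ℕ) :
    ((Finset.range N ×ˢ Finset.range N).filter fun p =>
      cellLo f g α s p < cellHi f g β s p).card ≤ 2 * N := by
  rw [← Finset.card_range (2 * N)]
  refine Finset.card_le_card_of_injOn (fun p => p.1 + (N - p.2)) ?_ ?_
  · intro p hp
    have hp := (Finset.mem_filter.mp (Finset.mem_coe.mp hp)).1
    simp only [Finset.mem_product, Finset.mem_range] at hp
    simp only [Finset.coe_range, Set.mem_Iio]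
    omega
  · have key : ∀ p q : ℕ × ℕ, cellLo f g α s p < cellHi f g β s p →
        cellLo f g α s q < cellHi f g β s q → p.1 < q.1 → p.2 < q.2 → False := by
      intro p q hp hq h1 h2
      have h3 := hf (Nat.succ_le_of_lt h1)
      have h4 := hg (Nat.succ_le_of_lt h2)
      unfold cellLo cellHi at hp hq
      simp only [Nat.succ_eq_add_one] at h3 h4
      omega
    intro p hp q hq hpq
    have hp := Finset.mem_filter.mp (Finset.mem_coe.mp hp)
    have hq := Finset.mem_filter.mp (Finset.mem_coe.mp hq)
    simp only [Finset.mem_product, Finset.mem_range] at hp hq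
    have k1 := key p q hp.2 hq.2
    have k2 := key q p hq.2 hp.2
    simp only at hpq
    have e1 : p.1 = q.1 := by
      by_contra hne
      rcases Nat.lt_or_gt_of_ne hne with h | h
      · exact k1 h (by omega)
      · exact k2 h (by omega)
    exact Prod.ext e1 (by omega)

end Cells

/-! ### From pairs of blocks to pairs of windows -/

section Blocks

variable {m n : ℕ}

/-- The part of the range `[α, β)` of heights that belongs to a pair of blocks admits a chain that
misses at most `thr` heights. -/
def BlockChain (T : Str m n) (I J : Window n) (y : ℕ) (thr α β s : ℤ) (p : ℕ × ℕ) : Prop :=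
  HasChain (HeightRel T (I.block y p.1) (J.block y p.2))
    (cellLo (futMin T I y) (pastMin T J y) α s p - baseHeight T I y p.1)
    (cellHi (futMin T I y) (pastMin T J y) β s p - baseHeight T I y p.1)
    (s + baseHeight T I y p.1 - baseHeight T J y p.2)
    (cellHi (futMin T I y) (pastMin T J y) β s p - cellLo (futMin T I y) (pastMin T J y) α s p - thr)

/-- The number of heights in `[α, β)` that belong to a pair of blocks. -/
noncomputable def blockWeight (T : Str m n) (I J : Window n) (y : ℕ) (α β s : ℤ) (p : ℕ × ℕ) : ℕ :=
  cellSize (futMin T I y) (pastMin T J y) α β s p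

open Classical in
/-- The pairs of blocks that do not admit a large chain. -/
noncomputable def badPairs (T : Str m n) (I J : Window n) (y N : ℕ) (thr α β s : ℤ) :
    Finset (ℕ × ℕ) :=
  (Finset.range N ×ˢ Finset.range N).filter fun p => ¬ BlockChain T I J y thr α β s p

lemma BlockChain.lift {T : Str m n} {I J : Window n} {y : ℕ} {thr α β s : ℤ} {p : ℕ × ℕ}
    (h : BlockChain T I J y thr α β s p) :
    HasChain (HeightRel T I J) (cellLo (futMin T I y) (pastMin T J y) α s p)
      (cellHi (futMin T I y) (pastMin T J y) β s p) s
      (cellHi (futMin T I y) (pastMin T J y) β s p -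
        cellLo (futMin T I y) (pastMin T J y) α s p - thr) := by
  refine HasChain.shift h fun h h' h1 h2 => ?_
  rintro ⟨i, j, hi, hj, hc⟩
  unfold cellLo cellHi at h1 h2
  exact ⟨i, j, hi.of_block (by omega), hj.of_block (by omega), hc⟩

/-- The chains for pairs of blocks combine to a chain for the whole windows. -/
lemma hasChain_of_blocks (T : Str m n) (I J : Window n) (y N : ℕ) {thr : ℤ} (hthr : 0 ≤ thr)
    (α β s : ℤ) :
    HasChain (HeightRel T I J) α β s
      (min β (min (futMin T I y N) (pastMin T J y 0 - s)) -
        max α (max (futMin T I y 0) (pastMin T J y N - s)) -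
        (∑ p ∈ badPairs T I J y N thr α β s, blockWeight T I J y α β s p : ℕ) - 2 * N * thr) := by
  classical
  set f := futMin T I y
  set g := pastMin T J y
  have hf : Monotone f := futMin_mono T I y
  have hg : Antitone g := pastMin_anti T J y
  set R := Finset.range N ×ˢ Finset.range N
  -- A good nonempty cell contributes its size minus `thr`, a bad cell at most `0`. Empty cells are
  -- not charged `thr`, which keeps the total charge at `2 * N * thr` instead of `N ^ 2 * thr`.
  set w : ℕ × ℕ → ℤ := fun p =>
    (cellSize f g α β s p : ℤ) - (if BlockChain T I J y thr α β s p then 0 else cellSize f g α β s p)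
      - (if cellLo f g α s p < cellHi f g β s p then thr else 0) with hw
  have key : HasChain (HeightRel T I J) α β s (∑ p ∈ R, w p) := by
    refine HasChain.biUnion R (A := cellLo f g α s) (B := cellHi f g β s)
      (fun p _ q _ hpq => cell_disjoint hf hg hpq) (fun p _ => ⟨?_, ?_⟩) fun p _ => ?_
    · unfold cellLo; omega
    · unfold cellHi; omega
    · by_cases hb : BlockChain T I J y thr α β s p
      · have h1 := hb.lift
        by_cases hlt : cellLo f g α s p < cellHi f g β s p
        · have e : w p = cellHi f g β s p - cellLo f g α s p - thr := by
            simp only [hw, if_pos hb, if_pos hlt, cellSize]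
            omega
          rw [e]
          exact h1
        · apply HasChain.of_nonpos
          simp only [hw, if_pos hb, if_neg hlt, cellSize]
          omega
      · apply HasChain.of_nonpos
        simp only [hw, if_neg hb]
        split_ifs <;> omega
  obtain ⟨S, h1, h2, h3⟩ := key
  refine ⟨S, h1, h2, le_trans ?_ h3⟩
  have e1 : ∑ p ∈ R, w p = ((∑ p ∈ R, cellSize f g α β s p : ℕ) : ℤ)
      - (∑ p ∈ badPairs T I J y N thr α β s, blockWeight T I J y α β s p : ℕ)
      - ((R.filter fun p => cellLo f g α s p < cellHi f g β s p).card : ℤ) * thr := by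
    simp only [hw, Finset.sum_sub_distrib, badPairs, Finset.sum_filter, blockWeight]
    congr 1
    · congr 1
      · push_cast; rfl
      · push_cast
        refine Finset.sum_congr rfl fun p _ => ?_
        by_cases hb : BlockChain T I J y thr α β s p <;> simp [hb, f, g]
    · rw [← Finset.sum_filter, Finset.sum_const, nsmul_eq_mul]
  have h4 := le_sum_cellSize f g α β s N
  have h5 := card_nonempty_cells_le (α := α) (β := β) (s := s) hf hg N
  have h6 : ((R.filter fun p => cellLo f g α s p < cellHi f g β s p).card : ℤ) * thr
      ≤ 2 * N * thr := mul_le_mul_of_nonneg_right (by exact_mod_cast h5) hthr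
  rw [e1]
  linarith

/-- The cells of a row are disjoint intervals between `futMin T I y a` and `futMin T I y (a + 1)`.
-/
lemma sum_blockWeight_row_le (T : Str m n) (I J : Window n) (y : ℕ) (α β s : ℤ) (a : ℕ)
    (P : Finset (ℕ × ℕ)) (hP : ∀ p ∈ P, p.1 = a) : ∑ p ∈ P, blockWeight T I J y α β s p ≤ y := by
  refine (sum_cellSize_le (A := futMin T I y a) (B := futMin T I y (a + 1)) (futMin_mono T I y)
    (pastMin_anti T J y) P ?_ ?_).trans ?_
  · intro p hp
    rw [← hP p hp]
    unfold cellLo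
    omega
  · intro p hp
    rw [← hP p hp]
    unfold cellHi
    omega
  · have := futMin_succ_le T I y a
    omega

lemma sum_blockWeight_col_le (T : Str m n) (I J : Window n) (y : ℕ) (α β s : ℤ) (b : ℕ)
    (P : Finset (ℕ × ℕ)) (hP : ∀ p ∈ P, p.2 = b) : ∑ p ∈ P, blockWeight T I J y α β s p ≤ y := by
  refine (sum_cellSize_le (A := pastMin T J y (b + 1) - s) (B := pastMin T J y b - s)
    (futMin_mono T I y) (pastMin_anti T J y) P ?_ ?_).trans ?_
  · intro p hp
    rw [← hP p hp]
    unfold cellLo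
    omega
  · intro p hp
    rw [← hP p hp]
    unfold cellHi
    omega
  · have := pastMin_le_succ T J y b
    omega

/-- Full matchings restrict to cells without loss, so the recursion can start from full matchings of
`T'` although it only produces chains in `T`. The new shift accounts for both base heights. -/
lemma FullMatch.block {T : Str m n} {I J : Window n} {α β s : ℤ} (h : FullMatch T I J α β s)
    (y : ℕ) (p : ℕ × ℕ) :
    FullMatch T (I.block y p.1) (J.block y p.2)
      (cellLo (futMin T I y) (pastMin T J y) α s p - baseHeight T I y p.1)
      (cellHi (futMin T I y) (pastMin T J y) β s p - baseHeight T I y p.1)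
      (s + baseHeight T I y p.1 - baseHeight T J y p.2) := by
  intro k h1 h2
  unfold cellLo cellHi at *
  obtain ⟨i, j, hi, hj, hc⟩ := h (k + baseHeight T I y p.1) (by omega) (by omega)
  refine ⟨i, j, ?_, ?_, hc⟩
  · have := hi.to_block (y := y) (a := p.1) (by omega) (by omega)
    rwa [add_sub_cancel_right] at this
  · have := hj.to_block (y := y) (b := p.2) (by omega) (by omega)
    convert this using 1
    ring

lemma HeightsClose.nonneg {T T' : Str m n} {I : Window n} {E : ℤ} (h : HeightsClose T T' I E) :
    0 ≤ E := (abs_nonneg _).trans (h I.lo le_rfl I.lo_le_hi)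

lemma HeightsClose.futMin {T T' : Str m n} {I : Window n} {E : ℤ} (h : HeightsClose T T' I E)
    (y a : ℕ) : |futMin T I y a - futMin T' I y a| ≤ E :=
  minOn_close (I.cut_le_hi y a) fun k h1 h2 => h k ((I.lo_le_cut y a).trans h1) h2

lemma HeightsClose.pastMin {T T' : Str m n} {I : Window n} {E : ℤ} (h : HeightsClose T T' I E)
    (y a : ℕ) : |pastMin T I y a - pastMin T' I y a| ≤ E :=
  minOn_close (I.lo_le_cut y a) fun k h1 h2 => h k h1 (h2.trans (I.cut_le_hi y a))

lemma HeightsClose.baseHeight {T T' : Str m n} {I : Window n} {E : ℤ} (h : HeightsClose T T' I E)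
    (y a : ℕ) : |baseHeight T I y a - baseHeight T' I y a| ≤ E :=
  h _ (I.lo_le_cut y a) (I.cut_le_hi y a)

/-- A pair of blocks to which full matchings of `T'` can be transferred is not bad. -/
lemma BlockChain.of_transfer {T T' : Str m n} {I J : Window n} {E d α β s : ℤ}
    (hI : HeightsClose T T' I E) (hJ : HeightsClose T T' J E) (hM : FullMatch T' I J α β s)
    (y : ℕ) (p : ℕ × ℕ) (hT : Transfer T T' (I.block y p.1) (J.block y p.2) d) :
    BlockChain T I J y (d + 14 * E) α β s p := by
  have hE := hI.nonneg
  have h1 := hT.2 _ _ _ (hM.block y p)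
  have a1 := abs_le.mp (hI.futMin y p.1)
  have a2 := abs_le.mp (hI.futMin y (p.1 + 1))
  have a3 := abs_le.mp (hJ.pastMin y p.2)
  have a4 := abs_le.mp (hJ.pastMin y (p.2 + 1))
  have a5 := abs_le.mp (hI.baseHeight y p.1)
  have a6 := abs_le.mp (hJ.baseHeight y p.2)
  unfold cellLo cellHi at h1
  unfold BlockChain cellLo cellHi
  -- Each endpoint moves by at most `E` for the cell and `E` for the base height, within the allowed
  -- `3 * E`. The change costs `12 * E`, and the cell sizes of `T` and `T'` differ by at most `2 *
  -- E`; hence `14 * E`.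
  have h2 := h1.change (E := 3 * E)
    (α' := max α (max (SubstringMatching.futMin T I y p.1)
      (SubstringMatching.pastMin T J y (p.2 + 1) - s)) - SubstringMatching.baseHeight T I y p.1)
    (β' := min β (min (SubstringMatching.futMin T I y (p.1 + 1))
      (SubstringMatching.pastMin T J y p.2 - s)) - SubstringMatching.baseHeight T I y p.1)
    (s' := s + SubstringMatching.baseHeight T I y p.1 - SubstringMatching.baseHeight T J y p.2)
    (by omega) (by omega) (by omega) (by omega) (by omega)
  obtain ⟨S, b1, b2, b3⟩ := h2
  exact ⟨S, b1, b2, by omega⟩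

lemma HasChain.mono {r : ℤ → ℤ → Prop} {α β s l l' : ℤ} (h : HasChain r α β s l) (hl : l' ≤ l) :
    HasChain r α β s l' := by
  obtain ⟨S, b1, b2, b3⟩ := h
  exact ⟨S, b1, b2, hl.trans b3⟩

lemma FullMatch.bounds {T : Str m n} {I J : Window n} {α β s : ℤ} (h : FullMatch T I J α β s)
    (hlt : α < β) {y N : ℕ} (hI : I.length ≤ N * y) (hJ : J.length ≤ N * y) :
    futMin T I y 0 ≤ α ∧ β ≤ futMin T I y N ∧
      pastMin T J y N ≤ α + s ∧ β + s ≤ pastMin T J y 0 := by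
  obtain ⟨i, j, hi, hj, -⟩ := h α le_rfl hlt
  obtain ⟨i', j', hi', hj', -⟩ := h (β - 1) (by omega) (by omega)
  have h1 := hi.futMin_bounds hI
  have h2 := hj.pastMin_bounds hJ
  have h3 := hi'.futMin_bounds hI
  have h4 := hj'.pastMin_bounds hJ
  omega

/-- If the bad pairs of blocks have small total weight, a full matching of `T'` transfers to `T`. -/
lemma hasChain_of_light_badPairs {T T' : Str m n} {I J : Window n} {E α β s thr : ℤ}
    (hI : HeightsClose T T' I E) (hJ : HeightsClose T T' J E) (hM : FullMatch T' I J α β s)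
    {y N : ℕ} (hIl : I.length ≤ N * y) (hJl : J.length ≤ N * y) (hthr : 0 ≤ thr) {W : ℤ}
    (hW : (∑ p ∈ badPairs T I J y N thr α β s, blockWeight T I J y α β s p : ℕ) ≤ W) :
    HasChain (HeightRel T I J) α β s (β - α - (2 * E + W + 2 * N * thr)) := by
  have hE := hI.nonneg
  by_cases hlt : α < β
  · refine (hasChain_of_blocks T I J y N hthr α β s).mono ?_
    -- The cells of `T'` cover all of `[α, β)`; those of `T` can miss `E` heights at either end.
    have h1 := hM.bounds hlt hIl hJl
    have a1 := abs_le.mp (hI.futMin y 0)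
    have a2 := abs_le.mp (hI.futMin y N)
    have a3 := abs_le.mp (hJ.pastMin y 0)
    have a4 := abs_le.mp (hJ.pastMin y N)
    have h2 : min β (min (futMin T I y N) (pastMin T J y 0 - s)) ≥ β - E := by omega
    have h3 : max α (max (futMin T I y 0) (pastMin T J y N - s)) ≤ α + E := by omega
    linarith
  · apply HasChain.of_nonpos
    have : 0 ≤ 2 * (N : ℤ) * thr := by positivity
    omega

end Blocks

/-! ### Uniform probability on finite types -/

open Classical in
/-- The probability of an event with respect to the uniform distribution. -/
noncomputable def prob {Ω : Type*} [Fintype Ω] (P : Ω → Prop) : ℝ :=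
  ((Finset.univ.filter P).card : ℝ) / Fintype.card Ω

section Prob

variable {Ω Ω' : Type*} [Fintype Ω] [Fintype Ω']

lemma prob_eq (P : Ω → Prop) [DecidablePred P] :
    prob P = ((Finset.univ.filter P).card : ℝ) / Fintype.card Ω := by
  unfold prob
  congr!

lemma prob_eq_zero {P : Ω → Prop} (h : ∀ ω, ¬ P ω) : prob P = 0 := by
  classical
  rw [prob_eq]
  simp [h]

lemma prob_nonneg (P : Ω → Prop) : 0 ≤ prob P := by
  unfold prob; positivity

lemma prob_mono {P Q : Ω → Prop} (h : ∀ ω, P ω → Q ω) : prob P ≤ prob Q := by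
  unfold prob
  gcongr with ω
  exact h ω

lemma prob_or_le (P Q : Ω → Prop) : prob (fun ω => P ω ∨ Q ω) ≤ prob P + prob Q := by
  classical
  rw [prob_eq, prob_eq, prob_eq, ← add_div]
  gcongr
  rw [Finset.filter_or]
  exact_mod_cast Finset.card_union_le _ _

lemma prob_exists_le {ι : Type*} (s : Finset ι) (P : ι → Ω → Prop) {B : ℝ}
    (hB : ∀ i ∈ s, prob (P i) ≤ B) : prob (fun ω => ∃ i ∈ s, P i ω) ≤ s.card * B := by
  classical
  induction s using Finset.induction_on with
  | empty => simp [prob]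
  | insert a s ha ih =>
    have h1 : prob (fun ω => ∃ i ∈ insert a s, P i ω) ≤
        prob (P a) + prob (fun ω => ∃ i ∈ s, P i ω) := by
      refine le_trans (prob_mono fun ω h => ?_) (prob_or_le _ _)
      simpa using h
    have h2 := hB a (Finset.mem_insert_self a s)
    have h3 := ih fun i hi => hB i (Finset.mem_insert_of_mem hi)
    rw [Finset.card_insert_of_notMem ha]
    push_cast
    linarith

lemma prob_fst [Nonempty Ω'] (P : Ω → Prop) : prob (fun ω : Ω × Ω' => P ω.1) = prob P := by
  classical
  rw [prob_eq, prob_eq]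
  have h : (Finset.univ.filter fun ω : Ω × Ω' => P ω.1) =
      Finset.univ.filter P ×ˢ (Finset.univ : Finset Ω') := by
    ext; simp
  rw [h, Finset.card_product, Fintype.card_prod, Finset.card_univ]
  have : (Fintype.card Ω' : ℝ) ≠ 0 := by exact_mod_cast Fintype.card_ne_zero
  push_cast
  rw [mul_div_mul_right _ _ this]

lemma prob_snd [Nonempty Ω] (P : Ω' → Prop) : prob (fun ω : Ω × Ω' => P ω.2) = prob P := by
  classical
  rw [prob_eq, prob_eq]
  have h : (Finset.univ.filter fun ω : Ω × Ω' => P ω.2) =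
      (Finset.univ : Finset Ω) ×ˢ Finset.univ.filter P := by
    ext; simp
  rw [h, Finset.card_product, Fintype.card_prod, Finset.card_univ]
  have : (Fintype.card Ω : ℝ) ≠ 0 := by exact_mod_cast Fintype.card_ne_zero
  push_cast
  rw [mul_div_mul_left _ _ this]

lemma prob_forall {ι : Type*} [Fintype ι] [DecidableEq ι] (P : ι → Ω → Prop) :
    prob (fun ω : ι → Ω => ∀ i, P i (ω i)) = ∏ i, prob (P i) := by
  classical
  rw [prob_eq]
  simp only [prob_eq]
  have h : (Finset.univ.filter fun ω : ι → Ω => ∀ i, P i (ω i)) =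
      Fintype.piFinset fun i => Finset.univ.filter (P i) := by
    ext; simp
  rw [h, Fintype.card_piFinset, Fintype.card_fun, Finset.prod_div_distrib]
  simp

lemma prob_eval [Nonempty Ω] {ι : Type*} [Fintype ι] [DecidableEq ι] (i : ι) (P : Ω → Prop) :
    prob (fun ω : ι → Ω => P (ω i)) = prob P := by
  have h := prob_forall (Ω := Ω) (ι := ι) fun j ω => j = i → P ω
  have e : (fun ω : ι → Ω => ∀ j, j = i → P (ω j)) = fun ω => P (ω i) := by
    funext ω; simp
  rw [e] at h
  rw [h, Finset.prod_eq_single i]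
  · simp
  · intro j _ hj
    have : (Fintype.card Ω : ℝ) ≠ 0 := by exact_mod_cast Fintype.card_ne_zero
    simp [prob, hj, this]
  · simp

/-- Markov's inequality: `f` dominates the indicator of `P`. -/
lemma prob_le_of_le_sum [Nonempty Ω] {P : Ω → Prop} {f : Ω → ℝ} (hf : ∀ ω, 0 ≤ f ω)
    (hP : ∀ ω, P ω → 1 ≤ f ω) : prob P ≤ (∑ ω, f ω) / Fintype.card Ω := by
  classical
  unfold prob
  gcongr
  rw [Finset.card_eq_sum_ones, Finset.sum_filter]
  push_cast
  refine Finset.sum_le_sum fun ω _ => ?_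
  split_ifs with h
  · simpa using hP ω h
  · exact hf ω

end Prob

/-! ### Concentration of sampled sums -/

lemma exp_le_quadratic {u : ℝ} (h : |u| ≤ 1) : Real.exp u ≤ 1 + u + u ^ 2 := by
  have := (abs_le.mp (Real.abs_exp_sub_one_sub_id_le h)).2
  linarith

/-- Exponential moments: as `Y` has mean zero and `Y ^ 2 ≤ 4`, the mean of `exp (θ * (Y - 8 * θ))`
is at most `exp (-(8 * θ ^ 2)) * (1 + 4 * θ ^ 2)`, hence at most `exp (-(4 * θ ^ 2))`. The samples
are independent. -/
lemma prob_sample_upper {x s : ℕ} (hx : 1 ≤ x) (Y : Fin x → ℝ) (hY : ∀ v, |Y v| ≤ 2)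
    (h0 : ∑ v, Y v = 0) {θ : ℝ} (hθ0 : 0 ≤ θ) (hθ : θ ≤ 1 / 2) :
    prob (fun ω : Fin s → Fin x => (8 * θ) * s ≤ ∑ j, Y (ω j)) ≤ Real.exp (-(4 * θ ^ 2 * s)) := by
  have : Nonempty (Fin x) := ⟨⟨0, hx⟩⟩
  have hx' : (0 : ℝ) < x := by exact_mod_cast hx
  refine (prob_le_of_le_sum (f := fun ω => ∏ j, Real.exp (θ * (Y (ω j) - 8 * θ)))
    (fun ω => Finset.prod_nonneg fun _ _ => (Real.exp_pos _).le) fun ω hω => ?_).trans ?_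
  · rw [← Real.exp_sum, Real.one_le_exp_iff, ← Finset.mul_sum, Finset.sum_sub_distrib]
    simp only [Finset.sum_const, Finset.card_univ, Fintype.card_fin, nsmul_eq_mul]
    exact mul_nonneg hθ0 (by linarith)
  · have h1 : ∑ ω : Fin s → Fin x, ∏ j, Real.exp (θ * (Y (ω j) - 8 * θ)) =
        (∑ v, Real.exp (θ * (Y v - 8 * θ))) ^ s := by
      rw [← Fintype.piFinset_univ, ← Finset.prod_univ_sum (fun _ => Finset.univ)
        (fun _ v => Real.exp (θ * (Y v - 8 * θ)))]
      simp
    have h2 : ∑ v, Real.exp (θ * (Y v - 8 * θ)) ≤ x * Real.exp (-(4 * θ ^ 2)) := by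
      have h3 : ∀ v, Real.exp (θ * (Y v - 8 * θ)) ≤
          Real.exp (-(8 * θ ^ 2)) * (1 + 4 * θ ^ 2 + θ * Y v) := by
        intro v
        have h4 : θ * (Y v - 8 * θ) = -(8 * θ ^ 2) + θ * Y v := by ring
        rw [h4, Real.exp_add]
        gcongr
        have h5 : |θ * Y v| ≤ 1 := by
          rw [abs_mul, abs_of_nonneg hθ0]
          nlinarith [hY v, abs_nonneg (Y v)]
        have h6 : Y v ^ 2 ≤ 4 := by
          rw [← sq_abs]
          nlinarith [hY v, abs_nonneg (Y v)]
        nlinarith [exp_le_quadratic h5, sq_nonneg θ]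
      refine (Finset.sum_le_sum fun v _ => h3 v).trans ?_
      rw [← Finset.mul_sum, Finset.sum_add_distrib, ← Finset.mul_sum, h0]
      simp only [Finset.sum_const, Finset.card_univ, Fintype.card_fin, nsmul_eq_mul, mul_zero,
        add_zero]
      have h7 : 1 + 4 * θ ^ 2 ≤ Real.exp (4 * θ ^ 2) := by
        linarith [Real.add_one_le_exp (4 * θ ^ 2)]
      have h8 : Real.exp (-(4 * θ ^ 2)) = Real.exp (-(8 * θ ^ 2)) * Real.exp (4 * θ ^ 2) := by
        rw [← Real.exp_add]; ring_nf
      rw [h8, mul_left_comm]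
      gcongr
    rw [h1, Fintype.card_fun, Fintype.card_fin, Fintype.card_fin]
    push_cast
    rw [div_le_iff₀ (by positivity)]
    calc (∑ v, Real.exp (θ * (Y v - 8 * θ))) ^ s ≤ (x * Real.exp (-(4 * θ ^ 2))) ^ s := by
          gcongr
      _ = Real.exp (-(4 * θ ^ 2 * s)) * x ^ s := by
          rw [mul_pow, ← Real.exp_nat_mul]
          ring_nf

/-- The sum of `x` numbers is estimated by sampling. -/
lemma prob_sample {x s : ℕ} (hx : 1 ≤ x) (hs : 1 ≤ s) (X : Fin x → ℝ) (hX : ∀ v, |X v| ≤ 1)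
    {e : ℝ} (he : 0 ≤ e) (hex : e ≤ x) :
    prob (fun ω : Fin s → Fin x => e < |x / s * ∑ j, X (ω j) - ∑ v, X v|) ≤
      2 * Real.exp (-(s * (e / x) ^ 2 / 16)) := by
  have hx' : (0 : ℝ) < x := by exact_mod_cast hx
  have hs' : (0 : ℝ) < s := by exact_mod_cast hs
  set μ : ℝ := (∑ v, X v) / x with hμ
  have hμx : ∑ v, X v = x * μ := by rw [hμ]; field_simp
  have hμ1 : |μ| ≤ 1 := by
    rw [hμ, abs_div, abs_of_pos hx', div_le_one hx']
    refine (Finset.abs_sum_le_sum_abs _ _).trans ((Finset.sum_le_sum fun v _ => hX v).trans ?_)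
    simp
  have hY : ∀ v, |X v - μ| ≤ 2 := fun v => (abs_sub _ _).trans (by linarith [hX v])
  have hY0 : ∑ v, (X v - μ) = 0 := by
    rw [Finset.sum_sub_distrib, hμx]; simp
  have hθ0 : 0 ≤ e / x / 8 := by positivity
  have hθ : e / x / 8 ≤ 1 / 2 := by
    have : e / x ≤ 1 := (div_le_one hx').mpr hex
    linarith
  have h1 := prob_sample_upper (s := s) hx (fun v => X v - μ) hY hY0 hθ0 hθ
  have h2 := prob_sample_upper (s := s) hx (fun v => -(X v - μ)) (fun v => by rw [abs_neg]; exact hY v)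
    (by rw [Finset.sum_neg_distrib, hY0, neg_zero]) hθ0 hθ
  have h3 : -(4 * (e / x / 8) ^ 2 * (s : ℝ)) = -(s * (e / x) ^ 2 / 16) := by ring
  rw [h3] at h1 h2
  have h4 : prob (fun ω : Fin s → Fin x => e < |x / s * ∑ j, X (ω j) - ∑ v, X v|) ≤
      prob (fun ω : Fin s → Fin x => (8 * (e / x / 8)) * s ≤ ∑ j, (X (ω j) - μ) ∨
        (8 * (e / x / 8)) * s ≤ ∑ j, -(X (ω j) - μ)) := by
    refine prob_mono fun ω hω => ?_
    have h5 : x / s * ∑ j, X (ω j) - ∑ v, X v = x / s * ∑ j, (X (ω j) - μ) := by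
      rw [Finset.sum_sub_distrib, hμx]
      simp only [Finset.sum_const, Finset.card_univ, Fintype.card_fin, nsmul_eq_mul]
      field_simp
    have h6 : (8 * (e / x / 8)) * s = s / x * e := by ring
    rw [h5, abs_mul, abs_of_pos (by positivity)] at hω
    have h7 : s / x * e ≤ |∑ j, (X (ω j) - μ)| := by
      have := mul_le_mul_of_nonneg_left hω.le (show (0 : ℝ) ≤ s / x by positivity)
      rwa [← mul_assoc, show (s : ℝ) / x * (x / s) = 1 by field_simp, one_mul] at this
    rw [h6, Finset.sum_neg_distrib]
    exact le_abs.mp h7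
  have h8 := prob_or_le (fun ω : Fin s → Fin x => (8 * (e / x / 8)) * s ≤ ∑ j, (X (ω j) - μ))
    (fun ω => (8 * (e / x / 8)) * s ≤ ∑ j, -(X (ω j) - μ))
  linarith

/-! ### Hitting a matching with random sets of size `√N` -/

/-- The number `a` is in the random set given by `r`, which has one element in each
interval `[c * g, (c + 1) * g)`. -/
def Selected {g : ℕ} (r : Fin g → Fin g) (a : ℕ) : Prop := ∃ c : Fin g, a = c * g + r c

lemma sum_range_mul_self (g : ℕ) (φ : ℕ → ℝ) :
    ∑ a ∈ Finset.range (g * g), φ a = ∑ c : Fin g, ∑ v : Fin g, φ (c * g + v) := by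
  rw [Finset.sum_range, ← finProdFinEquiv.sum_comp, Fintype.sum_prod_type]
  refine Finset.sum_congr rfl fun c _ => Finset.sum_congr rfl fun v _ => ?_
  congr 1
  simp [finProdFinEquiv]
  ring

/-- The choices in the `g` intervals are independent, so the average factors, and each factor is one
minus the mean of `1 - φ` on its interval. With `φ` the indicator of the complement of `Q` this
bounds the chance of missing `Q`; with `φ = exp (-(1 / g))` on `Q` it gives an exponential moment.
-/
lemma avg_prod_selected_le {g : ℕ} (hg : 1 ≤ g) (φ : ℕ → ℝ) (hφ : ∀ a, 0 ≤ φ a) :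
    (∑ r : Fin g → Fin g, ∏ c : Fin g, φ (c * g + r c)) / Fintype.card (Fin g → Fin g) ≤
      Real.exp (-((∑ a ∈ Finset.range (g * g), (1 - φ a)) / g)) := by
  have hg' : (0 : ℝ) < g := by exact_mod_cast hg
  have h1 : ∑ r : Fin g → Fin g, ∏ c : Fin g, φ (c * g + r c) =
      ∏ c : Fin g, ∑ v : Fin g, φ (c * g + v) := by
    rw [← Fintype.piFinset_univ, ← Finset.prod_univ_sum (fun _ => Finset.univ)
      (fun (c : Fin g) (v : Fin g) => φ (c * g + v))]
  rw [h1, Fintype.card_fun, Fintype.card_fin, sum_range_mul_self, Finset.sum_div,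
    ← Finset.sum_neg_distrib, Real.exp_sum]
  push_cast
  have h2 : (g : ℝ) ^ g = ∏ _c : Fin g, (g : ℝ) := by simp
  rw [h2, ← Finset.prod_div_distrib]
  refine Finset.prod_le_prod (fun c _ => div_nonneg (Finset.sum_nonneg fun _ _ => hφ _) hg'.le)
    fun c _ => ?_
  rw [Finset.sum_sub_distrib]
  simp only [Finset.sum_const, Finset.card_univ, Fintype.card_fin, nsmul_eq_mul, mul_one]
  refine le_trans (le_of_eq ?_) (Real.add_one_le_exp _)
  field_simp
  ring

lemma exp_neg_le_half {u : ℝ} (h0 : 0 ≤ u) (h1 : u ≤ 1) : Real.exp (-u) ≤ 1 - u / 2 := by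
  have := exp_le_quadratic (u := -u) (by rw [abs_neg, abs_of_nonneg h0]; exact h1)
  rcases le_or_gt u (1 / 2) with h | h
  · nlinarith
  · rw [Real.exp_neg, inv_le_comm₀ (Real.exp_pos _) (by linarith)]
    refine le_trans ?_ (Real.add_one_le_exp u)
    rw [inv_le_comm₀ (by linarith) (by linarith), ← one_div, div_le_iff₀ (by linarith)]
    nlinarith

lemma prob_no_selected_le {g : ℕ} (hg : 1 ≤ g) (Q : Finset ℕ) (hQ : Q ⊆ Finset.range (g * g)) :
    prob (fun r : Fin g → Fin g => ∀ a ∈ Q, ¬ Selected r a) ≤ Real.exp (-(Q.card / g)) := by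
  have : Nonempty (Fin g) := ⟨⟨0, hg⟩⟩
  obtain ⟨φ, hφ⟩ : ∃ φ : ℕ → ℝ, ∀ a, φ a = if a ∈ Q then 0 else 1 := ⟨_, fun _ => rfl⟩
  have hφ0 : ∀ a, 0 ≤ φ a := fun a => by rw [hφ]; split_ifs <;> norm_num
  have h1 := avg_prod_selected_le hg φ hφ0
  have h2 : ∑ a ∈ Finset.range (g * g), (1 - φ a) = Q.card := by
    have e1 : ∀ a, 1 - φ a = if a ∈ Q then 1 else 0 := by
      intro a; rw [hφ]; split_ifs <;> norm_num
    simp only [e1]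
    rw [← Finset.sum_filter, Finset.sum_const, Finset.filter_mem_eq_inter,
      Finset.inter_eq_right.mpr hQ]
    simp
  rw [h2] at h1
  refine le_trans (prob_le_of_le_sum (f := fun r => ∏ c : Fin g, φ (c * g + r c))
    (fun r => Finset.prod_nonneg fun c _ => hφ0 _) fun r hr => ?_) h1
  rw [Finset.prod_eq_one]
  intro c _
  rw [hφ, if_neg]
  exact fun h => hr _ h ⟨c, rfl⟩

open Classical in
lemma avg_exp_selected_le {g : ℕ} (hg : 1 ≤ g) (Q : Finset ℕ) (hQ : Q ⊆ Finset.range (g * g)) :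
    (∑ r : Fin g → Fin g, Real.exp (-((Q.filter (Selected r)).card / g))) /
      Fintype.card (Fin g → Fin g) ≤ Real.exp (-(Q.card / (2 * g ^ 2))) := by
  have hg' : (1 : ℝ) ≤ g := by exact_mod_cast hg
  have h1 := avg_prod_selected_le hg (fun a => if a ∈ Q then Real.exp (-(1 / g)) else 1)
    (fun a => by split_ifs <;> positivity)
  have e1 : ∀ r : Fin g → Fin g, Real.exp (-((Q.filter (Selected r)).card / g)) =
      ∏ c : Fin g, if c * g + (r c : ℕ) ∈ Q then Real.exp (-(1 / g)) else 1 := by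
    intro r
    rw [← Finset.prod_filter, Finset.prod_const, ← Real.exp_nat_mul]
    have : (Q.filter (Selected r)).card =
        (Finset.univ.filter fun c : Fin g => c * g + (r c : ℕ) ∈ Q).card := by
      symm
      refine Finset.card_bij (fun c _ => c * g + (r c : ℕ)) ?_ ?_ ?_
      · intro c hc
        exact Finset.mem_filter.mpr ⟨(Finset.mem_filter.mp hc).2, c, rfl⟩
      · intro c _ c' _ h
        have h2 : ∀ c : Fin g, (c * g + (r c : ℕ)) / g = c := fun c => by
          rw [mul_comm, Nat.mul_add_div (by omega), Nat.div_eq_of_lt (r c).2, add_zero]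
        have := congrArg (· / g) h
        simp only [h2] at this
        exact Fin.ext this
      · rintro a ha
        obtain ⟨h3, c, rfl⟩ := Finset.mem_filter.mp ha
        exact ⟨c, by simpa using h3, rfl⟩
    rw [this]
    congr 1
    ring
  simp only [e1]
  refine h1.trans (Real.exp_le_exp.mpr ?_)
  have e2 : ∀ a, (1 : ℝ) - (if a ∈ Q then Real.exp (-(1 / (g : ℝ))) else 1) =
      if a ∈ Q then 1 - Real.exp (-(1 / (g : ℝ))) else 0 := by
    intro a; split_ifs <;> norm_num
  simp only [e2]
  rw [← Finset.sum_filter, Finset.sum_const, Finset.filter_mem_eq_inter,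
    Finset.inter_eq_right.mpr hQ, nsmul_eq_mul]
  have h2 := exp_neg_le_half (u := 1 / (g : ℝ)) (by positivity)
    ((div_le_one (by positivity)).mpr hg')
  have h3 : (Q.card : ℝ) / (2 * g ^ 2) = Q.card * (1 / g / 2) / g := by field_simp
  rw [h3]
  gcongr
  linarith

/-- Both coordinates of some pair in `P` are selected. -/
def Hits {g : ℕ} (u : (Fin g → Fin g) × (Fin g → Fin g)) (P : Finset (ℕ × ℕ)) : Prop :=
  ∃ p ∈ P, Selected u.1 p.1 ∧ Selected u.2 p.2

/-- Conditioning on the first coordinate. -/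
lemma prob_prod_le {Ω Ω' : Type*} [Fintype Ω] [Fintype Ω'] (P : Ω → Ω' → Prop) (f : Ω → ℝ)
    (h : ∀ ω, prob (P ω) ≤ f ω) :
    prob (fun u : Ω × Ω' => P u.1 u.2) ≤ (∑ ω, f ω) / Fintype.card Ω := by
  classical
  have e : prob (fun u : Ω × Ω' => P u.1 u.2) = (∑ ω, prob (P ω)) / Fintype.card Ω := by
    unfold prob
    rw [← Finset.sum_div, div_div, Fintype.card_prod]
    push_cast
    rw [mul_comm (Fintype.card Ω : ℝ)]
    congr 1
    norm_cast
    rw [Finset.card_filter, Fintype.sum_prod_type]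
    exact Finset.sum_congr rfl fun ω _ => by rw [Finset.card_filter]
  rw [e]
  gcongr
  exact h _

/-- Birthday argument in two stages: if the first random set selects `k` first coordinates, their
partners are `k` distinct targets, all missed by the second set with probability at most `exp (-(k /
g))`. Averaging over the first set uses `avg_exp_selected_le`. -/
lemma prob_not_hits_matching_le {g : ℕ} (hg : 1 ≤ g) (P : Finset (ℕ × ℕ))
    (hP : P ⊆ Finset.range (g * g) ×ˢ Finset.range (g * g))
    (h1 : Set.InjOn Prod.fst (P : Set (ℕ × ℕ))) (h2 : Set.InjOn Prod.snd (P : Set (ℕ × ℕ))) :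
    prob (fun u : (Fin g → Fin g) × (Fin g → Fin g) => ¬ Hits u P) ≤
      Real.exp (-(P.card / (2 * g ^ 2))) := by
  classical
  have hQ : P.image Prod.fst ⊆ Finset.range (g * g) := by
    intro a ha
    obtain ⟨p, hp, rfl⟩ := Finset.mem_image.mp ha
    exact (Finset.mem_product.mp (hP hp)).1
  have h3 := avg_exp_selected_le hg (P.image Prod.fst) hQ
  rw [Finset.card_image_of_injOn h1] at h3
  refine le_trans (prob_prod_le (fun r r' => ¬ Hits (r, r') P) _ fun r => ?_) h3
  set P' := P.filter fun p => Selected r p.1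
  have h4 : ((P.image Prod.fst).filter (Selected r)).card = (P'.image Prod.snd).card := by
    rw [Finset.card_image_of_injOn (h2.mono (by
      intro p hp; exact (Finset.mem_filter.mp (Finset.mem_coe.mp hp)).1)),
      Finset.filter_image, Finset.card_image_of_injOn (h1.mono (by
      intro p hp; exact (Finset.mem_filter.mp (Finset.mem_coe.mp hp)).1))]
  rw [h4]
  refine (prob_mono fun r' hr' => ?_).trans (prob_no_selected_le hg (P'.image Prod.snd) ?_)
  · intro b hb hsel
    obtain ⟨p, hp, rfl⟩ := Finset.mem_image.mp hb
    have hp := Finset.mem_filter.mp hp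
    exact hr' ⟨p, hp.1, hp.2, hsel⟩
  · intro b hb
    obtain ⟨p, hp, rfl⟩ := Finset.mem_image.mp hb
    exact (Finset.mem_product.mp (hP (Finset.mem_filter.mp hp).1)).2

lemma sum_biUnion_le_sum {ι κ : Type*} [DecidableEq ι] [DecidableEq κ] (s : Finset ι)
    (t : ι → Finset κ) (w : κ → ℕ) : ∑ p ∈ s.biUnion t, w p ≤ ∑ v ∈ s, ∑ p ∈ t v, w p := by
  induction s using Finset.induction_on with
  | empty => simp
  | insert a s ha ih =>
    rw [Finset.biUnion_insert, Finset.sum_insert ha]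
    have := Finset.sum_union_inter (s₁ := t a) (s₂ := s.biUnion t) (f := w)
    omega

/-- A heavy set of pairs with small row and column sums contains a large matching. -/
lemma exists_matching (P : Finset (ℕ × ℕ)) (w : ℕ × ℕ → ℕ) (y : ℕ)
    (hrow : ∀ a, ∀ P' ⊆ P, (∀ p ∈ P', p.1 = a) → ∑ p ∈ P', w p ≤ y)
    (hcol : ∀ b, ∀ P' ⊆ P, (∀ p ∈ P', p.2 = b) → ∑ p ∈ P', w p ≤ y) :
    ∃ M ⊆ P, Set.InjOn Prod.fst (M : Set (ℕ × ℕ)) ∧ Set.InjOn Prod.snd (M : Set (ℕ × ℕ)) ∧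
      ∑ p ∈ P, w p ≤ M.card * (2 * y) := by
  classical
  set C := P.powerset.filter fun M : Finset (ℕ × ℕ) =>
    Set.InjOn Prod.fst (M : Set (ℕ × ℕ)) ∧ Set.InjOn Prod.snd (M : Set (ℕ × ℕ))
  have hC : C.Nonempty := ⟨∅, by simp [C]⟩
  obtain ⟨M, hM, hmax⟩ := C.exists_max_image Finset.card hC
  obtain ⟨hMP, hM1, hM2⟩ : M ⊆ P ∧ Set.InjOn Prod.fst (M : Set (ℕ × ℕ)) ∧
      Set.InjOn Prod.snd (M : Set (ℕ × ℕ)) := by simpa [C] using hM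
  refine ⟨M, hMP, hM1, hM2, ?_⟩
  -- By maximality of `M`, every pair shares a row or a column with a member of `M`; each member
  -- thus accounts for weight at most `2 * y`.
  have hcov : P ⊆ M.biUnion fun v => (P.filter fun p => p.1 = v.1) ∪ P.filter fun p => p.2 = v.2 := by
    intro p hp
    by_contra hc
    simp only [Finset.mem_biUnion, Finset.mem_union, Finset.mem_filter, not_exists, not_and,
      not_or] at hc
    have hpM : p ∉ M := fun h => (hc p h).1 hp rfl
    have : insert p M ∈ C := by
      simp only [C, Finset.mem_filter, Finset.mem_powerset, Finset.coe_insert]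
      refine ⟨Finset.insert_subset hp hMP, ?_, ?_⟩
      · rw [Set.injOn_insert (by simpa using hpM)]
        refine ⟨hM1, ?_⟩
        rintro ⟨v, hv, e⟩
        exact (hc v hv).1 hp e.symm
      · rw [Set.injOn_insert (by simpa using hpM)]
        refine ⟨hM2, ?_⟩
        rintro ⟨v, hv, e⟩
        exact (hc v hv).2 hp e.symm
    have := hmax _ this
    rw [Finset.card_insert_of_notMem hpM] at this
    omega
  calc ∑ p ∈ P, w p ≤ ∑ p ∈ M.biUnion fun v =>
        (P.filter fun p => p.1 = v.1) ∪ P.filter fun p => p.2 = v.2, w p :=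
        Finset.sum_le_sum_of_subset hcov
    _ ≤ ∑ v ∈ M, ∑ p ∈ (P.filter fun p => p.1 = v.1) ∪ P.filter fun p => p.2 = v.2, w p :=
        sum_biUnion_le_sum _ _ _
    _ ≤ ∑ v ∈ M, 2 * y := by
        refine Finset.sum_le_sum fun v _ => ?_
        have h1 := hrow v.1 (P.filter fun p => p.1 = v.1) (Finset.filter_subset _ _) (by simp)
        have h2 := hcol v.2 (P.filter fun p => p.2 = v.2) (Finset.filter_subset _ _) (by simp)
        have h3 := Finset.sum_union_inter (s₁ := P.filter fun p => p.1 = v.1)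
          (s₂ := P.filter fun p => p.2 = v.2) (f := w)
        omega
    _ = M.card * (2 * y) := by simp

lemma prob_not_hits_le {g : ℕ} (hg : 1 ≤ g) (P : Finset (ℕ × ℕ))
    (hP : P ⊆ Finset.range (g * g) ×ˢ Finset.range (g * g)) (w : ℕ × ℕ → ℕ) {y W : ℕ} (hy : 1 ≤ y)
    (hrow : ∀ a, ∀ P' ⊆ P, (∀ p ∈ P', p.1 = a) → ∑ p ∈ P', w p ≤ y)
    (hcol : ∀ b, ∀ P' ⊆ P, (∀ p ∈ P', p.2 = b) → ∑ p ∈ P', w p ≤ y)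
    (hW : W ≤ ∑ p ∈ P, w p) :
    prob (fun u : (Fin g → Fin g) × (Fin g → Fin g) => ¬ Hits u P) ≤
      Real.exp (-(W / (4 * y * g ^ 2))) := by
  obtain ⟨M, hMP, h1, h2, h3⟩ := exists_matching P w y hrow hcol
  have h0 : ∀ u : (Fin g → Fin g) × (Fin g → Fin g), Hits u M → Hits u P :=
    fun u ⟨p, hp, hs⟩ => ⟨p, hMP hp, hs⟩
  refine (prob_mono fun u => mt (h0 u)).trans
    ((prob_not_hits_matching_le hg M (hMP.trans hP) h1 h2).trans (Real.exp_le_exp.mpr ?_))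
  have hg' : (0 : ℝ) < g := by exact_mod_cast hg
  have hy' : (0 : ℝ) < y := by exact_mod_cast hy
  have h4 : (W : ℝ) ≤ M.card * (2 * y) := by exact_mod_cast hW.trans h3
  rw [neg_le_neg_iff, div_le_div_iff₀ (by positivity) (by positivity)]
  nlinarith [mul_le_mul_of_nonneg_right h4 (show (0 : ℝ) ≤ 2 * g ^ 2 by positivity)]

/-! ### Height estimates -/

section Estimate

variable {m n x s : ℕ}

/-- The contribution of the `v`-th position of the window `I` to the height at `k`. -/
def heightTerm (T : Str m n) (I : Window n) (k : ℕ) (v : Fin x) : ℝ :=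
  if I.lo + v < k then (stepAt T (I.lo + v) : ℝ) else 0

lemma sum_heightTerm (T : Str m n) {I : Window n} {k : ℕ} (h1 : I.lo ≤ k) (h2 : k ≤ I.lo + x) :
    ∑ v : Fin x, heightTerm T I k v = ((height T k - height T I.lo : ℤ) : ℝ) := by
  obtain ⟨l, rfl⟩ := Nat.exists_eq_add_of_le h1
  have h3 : height T (I.lo + l) - height T I.lo = ∑ v ∈ Finset.range l, stepAt T (I.lo + v) := by
    rw [height, Finset.sum_range_add]
    exact add_sub_cancel_left _ _
  rw [h3]
  unfold heightTerm
  rw [← Finset.sum_range (fun v => if I.lo + v < I.lo + l then (stepAt T (I.lo + v) : ℝ) else 0),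
    ← Finset.sum_filter]
  have h4 : (Finset.range x).filter (fun v => I.lo + v < I.lo + l) = Finset.range l := by
    ext v
    simp only [Finset.mem_filter, Finset.mem_range]
    omega
  rw [h4]
  push_cast
  rfl

/-- The estimate of the height at `k` from the sample `ω`. -/
noncomputable def heightEstimate (ω : Fin s → Fin x) (T : Str m n) (I : Window n) (k : ℕ) : ℝ :=
  x / s * ∑ j, heightTerm T I k (ω j)

/-- The sample `ω` estimates all heights in the window `I` up to `e`. -/
def WellSampled (e : ℝ) (ω : Fin s → Fin x) (T : Str m n) (I : Window n) : Prop :=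
  ∀ k, I.lo ≤ k → k ≤ I.hi →
    |heightEstimate ω T I k - ((height T k - height T I.lo : ℤ) : ℝ)| ≤ e

/-- A union bound over the `n + 1` possible positions `k`; one sample serves all of them. -/
lemma prob_not_wellSampled_le (hx : 1 ≤ x) (hs : 1 ≤ s) (T : Str m n) {I : Window n}
    (hI : I.length ≤ x) {e : ℝ} (he : 0 ≤ e) (hex : e ≤ x) :
    prob (fun ω : Fin s → Fin x => ¬ WellSampled e ω T I) ≤
      (n + 1) * (2 * Real.exp (-(s * (e / x) ^ 2 / 16))) := by
  have h1 := prob_exists_le (Finset.range (n + 1))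
    (fun k (ω : Fin s → Fin x) => I.lo ≤ k ∧ k ≤ I.hi ∧
      e < |heightEstimate ω T I k - ((height T k - height T I.lo : ℤ) : ℝ)|)
    (B := 2 * Real.exp (-(s * (e / x) ^ 2 / 16))) fun k _ => by
      by_cases hk : I.lo ≤ k ∧ k ≤ I.hi
      · refine (prob_mono fun ω h => ?_).trans
          (prob_sample hx hs (heightTerm T I k) (fun v => ?_) he hex)
        · rw [sum_heightTerm T hk.1 (by unfold Window.length at hI; omega)]
          exact h.2.2
        · unfold heightTerm
          split_ifs
          · exact_mod_cast abs_stepAt_le T _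
          · simp
      · refine le_trans (prob_eq_zero fun ω h => hk ⟨h.1, h.2.1⟩).le (by positivity)
  refine (prob_mono fun ω h => ?_).trans (h1.trans (le_of_eq (by simp)))
  unfold WellSampled at h
  push Not at h
  obtain ⟨k, h2, h3, h4⟩ := h
  exact ⟨k, by have := I.hi_le; simp; omega, h2, h3, h4⟩

open Classical in
/-- The sampled positions. -/
noncomputable def sampledPositions (ω : Fin s → Fin x) (I : Window n) : Finset (Fin n) :=
  Finset.univ.filter fun i => ∃ j, I.lo + (ω j : ℕ) = i

lemma card_sampledPositions_le (ω : Fin s → Fin x) (I : Window n) :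
    (sampledPositions ω I).card ≤ s := by
  classical
  have h1 : (sampledPositions ω I).image (fun i : Fin n => (i : ℕ)) ⊆
      Finset.univ.image fun j => I.lo + (ω j : ℕ) := by
    intro v hv
    obtain ⟨i, hi, rfl⟩ := Finset.mem_image.mp hv
    obtain ⟨j, hj⟩ := (Finset.mem_filter.mp hi).2
    exact Finset.mem_image.mpr ⟨j, Finset.mem_univ _, hj⟩
  have h2 := (Finset.card_le_card h1).trans Finset.card_image_le
  rwa [Finset.card_image_of_injective _ Fin.val_injective, Finset.card_univ,
    Fintype.card_fin] at h2

/-- The estimate depends only on sampled positions, so both strings have the same one, within `e` of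
either height. -/
lemma heightsClose_of_wellSampled {e : ℝ} {ω : Fin s → Fin x} {T T' : Str m n} {I : Window n}
    (hT : WellSampled e ω T I) (hT' : WellSampled e ω T' I)
    (h : ∀ i ∈ sampledPositions ω I, T i = T' i) : HeightsClose T T' I ⌊2 * e⌋ := by
  intro k h1 h2
  have h3 : heightEstimate ω T I k = heightEstimate ω T' I k := by
    unfold heightEstimate heightTerm
    congr 1
    refine Finset.sum_congr rfl fun j _ => ?_
    split_ifs with hk
    · have hn : I.lo + (ω j : ℕ) < n := by have := I.hi_le; omega
      have := h ⟨_, hn⟩ (by simp [sampledPositions])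
      simp only [stepAt, dif_pos hn, this]
    · rfl
  have h4 := abs_le.mp (hT k h1 h2)
  have h5 := abs_le.mp (hT' k h1 h2)
  rw [h3] at h4
  rw [Int.le_floor]
  push_cast at h4 h5 ⊢
  rw [abs_le]
  constructor <;> linarith [h4.1, h4.2, h5.1, h5.2]

end Estimate

/-! ### Samplers -/

/-- There are randomized sets of at most `B` queries for each of two windows of length at most `x`
such that, except with probability `η`, the answers to the queries determine up to `l` which
matchings are possible. -/
def HasSampler (m n x : ℕ) (l : ℤ) (η B : ℝ) : Prop :=
  ∃ (Ω : Type) (_ : Fintype Ω) (_ : Nonempty Ω) (F G : Ω → Window n → Finset (Fin n))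
    (Good : Ω → Str m n → Window n → Window n → Prop),
    (∀ ω I, I.length ≤ x → ((F ω I).card : ℝ) ≤ B ∧ ((G ω I).card : ℝ) ≤ B) ∧
    (∀ T I J, I.length ≤ x → J.length ≤ x → prob (fun ω => ¬ Good ω T I J) ≤ η) ∧
    ∀ ω T T' I J, I.length ≤ x → J.length ≤ x → Good ω T I J → Good ω T' I J →
      (∀ i ∈ F ω I, T i = T' i) → (∀ i ∈ G ω J, T i = T' i) → Transfer T T' I J l

lemma HasSampler.mono {m n x : ℕ} {l l' : ℤ} {η η' B B' : ℝ} (h : HasSampler m n x l η B)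
    (hl : l ≤ l') (hη : η ≤ η') (hB : B ≤ B') : HasSampler m n x l' η' B' := by
  obtain ⟨Ω, i1, i2, F, G, Good, h1, h2, h3⟩ := h
  refine ⟨Ω, i1, i2, F, G, Good, fun ω I hI => ?_, fun T I J hI hJ => (h2 T I J hI hJ).trans hη,
    fun ω T T' I J hI hJ g1 g2 e1 e2 => ?_⟩
  · exact ⟨(h1 ω I hI).1.trans hB, (h1 ω I hI).2.trans hB⟩
  · obtain ⟨a, b⟩ := h3 ω T T' I J hI hJ g1 g2 e1 e2
    exact ⟨fun k k1 k2 => (a k k1 k2).trans hl, fun α β s hM => (b α β s hM).mono (by omega)⟩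

/-! ### The sampler that reads everything -/

section Trivial

variable {m n : ℕ}

/-- All positions in a window. -/
def Window.positions (I : Window n) : Finset (Fin n) :=
  Finset.univ.filter fun i => I.lo ≤ (i : ℕ) ∧ (i : ℕ) < I.hi

lemma Window.card_positions_le (I : Window n) : I.positions.card ≤ I.length := by
  have h1 : I.positions.card ≤ (Finset.Ico I.lo I.hi).card := by
    refine Finset.card_le_card_of_injOn (fun i => (i : ℕ)) (fun i hi => ?_)
      Fin.val_injective.injOn
    have := (Finset.mem_filter.mp (Finset.mem_coe.mp hi)).2
    simpa using this
  simpa [Window.length] using h1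

lemma height_sub_eq {T T' : Str m n} {I : Window n} (h : ∀ i ∈ I.positions, T i = T' i) {k : ℕ}
    (h1 : I.lo ≤ k) (h2 : k ≤ I.hi) :
    height T k - height T I.lo = height T' k - height T' I.lo := by
  induction k, h1 using Nat.le_induction with
  | base => simp
  | succ k hk ih =>
    have hn : k < n := by have := I.hi_le; omega
    have h3 : stepAt T k = stepAt T' k := by
      have := h ⟨k, hn⟩ (by simp [Window.positions]; omega)
      simp [stepAt, hn, this]
    rw [height_succ, height_succ, h3]
    have := ih (by omega)
    omega

lemma transfer_of_eq {T T' : Str m n} {I J : Window n} (hI : ∀ i ∈ I.positions, T i = T' i)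
    (hJ : ∀ i ∈ J.positions, T i = T' i) : Transfer T T' I J 0 := by
  refine ⟨fun k h1 h2 => by rw [height_sub_eq hI h1 h2]; simp, fun α β s hM => ?_⟩
  have key : ∀ h, α ≤ h → h < β → HeightRel T I J h (h + s) := by
    intro h h1 h2
    obtain ⟨i, j, hi, hj, hc⟩ := hM h h1 h2
    have ei : T i = T' i := hI i (by simp [Window.positions]; exact ⟨hi.1, hi.2.1⟩)
    have ej : T j = T' j := hJ j (by simp [Window.positions]; exact ⟨hj.1, hj.2.1⟩)
    refine ⟨i, j, ⟨hi.1, hi.2.1, ?_, fun k k1 k2 => ?_⟩, ⟨hj.1, hj.2.1, ?_, fun k k1 k2 => ?_⟩, ?_⟩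
    · rw [height_sub_eq hI hi.1 hi.2.1.le]
      exact hi.2.2.1
    · have a1 := height_sub_eq hI hi.1 hi.2.1.le
      have a2 := height_sub_eq hI (hi.1.trans k1.le) k2
      have := hi.2.2.2 k k1 k2
      omega
    · rw [height_sub_eq hJ (hj.1.trans (Nat.le_succ _)) hj.2.1]
      exact hj.2.2.1
    · have a1 := height_sub_eq hJ (hj.1.trans (Nat.le_succ _)) hj.2.1
      have a2 := height_sub_eq hJ k1 (k2.trans hj.2.1.le)
      have := hj.2.2.2 k k1 k2
      simp only [Nat.succ_eq_add_one] at a1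
      omega
    · unfold Compatible
      rw [ei, ej]
      exact hc
  refine ⟨(Finset.Ico α β).image fun h => (h, h + s), ?_, ?_, ?_⟩
  · intro p hp q hq
    obtain ⟨a, -, rfl⟩ := Finset.mem_image.mp hp
    obtain ⟨b, -, rfl⟩ := Finset.mem_image.mp hq
    simp
  · intro p hp
    obtain ⟨a, ha, rfl⟩ := Finset.mem_image.mp hp
    have ha := Finset.mem_Ico.mp ha
    exact ⟨key a ha.1 ha.2, ha, by simpa using ha⟩
  · rw [Finset.card_image_of_injective _ fun a b h => congrArg Prod.fst h]
    simp

/-- Querying everything. -/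
lemma HasSampler.trivial (m n x : ℕ) : HasSampler m n x 0 0 x := by
  refine ⟨Unit, inferInstance, inferInstance, fun _ I => I.positions, fun _ I => I.positions,
    fun _ _ _ _ => True, fun _ I hI => ?_, fun _ _ _ _ _ => by simp [prob_eq],
    fun _ T T' I J _ _ _ _ e1 e2 => transfer_of_eq e1 e2⟩
  have : (I.positions.card : ℝ) ≤ x := by exact_mod_cast I.card_positions_le.trans hI
  exact ⟨this, this⟩

end Trivial

/-! ### One step of the recursion -/

section Step

variable {m n : ℕ}

lemma abs_height_sub_le (T : Str m n) {a b k : ℕ} (h1 : a ≤ k) (h2 : k ≤ b) :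
    |height T k - height T a| ≤ b := by
  have h3 := height_add_bounds T a (k - a)
  rw [Nat.add_sub_cancel' h1] at h3
  rw [abs_le]
  omega

/-- Only polynomially many triples `(α, β, s)` matter, which permits a union bound over them. Empty
ranges are excluded, as they constrain nothing. -/
lemma FullMatch.param_bounds {T : Str m n} {I J : Window n} {α β s : ℤ}
    (h : FullMatch T I J α β s) (hlt : α < β) :
    |α| ≤ 2 * n + 1 ∧ |β| ≤ 2 * n + 1 ∧ |s| ≤ 2 * n + 1 := by
  obtain ⟨i, j, hi, hj, -⟩ := h α le_rfl hlt
  obtain ⟨i', j', hi', hj', -⟩ := h (β - 1) (by omega) (by omega)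
  have h1 := abs_le.mp (abs_height_sub_le T hi.1 i.2.le)
  have h2 := abs_le.mp (abs_height_sub_le T hi'.1 i'.2.le)
  have h3 := abs_le.mp (abs_height_sub_le T (hj.1.trans (Nat.le_succ j)) j.2)
  have e1 := hi.2.2.1
  have e2 := hi'.2.2.1
  have e3 := hj.2.2.1
  simp only [Nat.succ_eq_add_one] at h3
  simp only [abs_le]
  omega

/-- The ranges `[α, β)` and shifts `s` of heights that can occur. -/
noncomputable def paramRange (n : ℕ) : Finset (ℤ × ℤ × ℤ) :=
  Finset.Icc (-(2 * (n : ℤ) + 1)) (2 * n + 1) ×ˢ Finset.Icc (-(2 * (n : ℤ) + 1)) (2 * n + 1) ×ˢ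
    Finset.Icc (-(2 * (n : ℤ) + 1)) (2 * n + 1)

lemma card_paramRange (n : ℕ) : (paramRange n).card = (4 * n + 3) ^ 3 := by
  have : (Finset.Icc (-(2 * (n : ℤ) + 1)) (2 * n + 1)).card = 4 * n + 3 := by
    rw [Int.card_Icc]; omega
  rw [paramRange, Finset.card_product, Finset.card_product, this]
  ring

/-- The trials `ω` hit a bad pair of blocks whenever the bad pairs have total weight over `W`. -/
def HitsBadPairs {Ω : Type*} {g t : ℕ} (y W : ℕ) (thr : ℤ)
    (ω : Fin t → ((Fin g → Fin g) × (Fin g → Fin g)) × Ω) (T : Str m n) (I J : Window n) : Prop :=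
  ∀ q ∈ paramRange n,
    W < ∑ p ∈ badPairs T I J y (g * g) thr q.1 q.2.1 q.2.2, blockWeight T I J y q.1 q.2.1 q.2.2 p →
    ∃ τ, Hits (ω τ).1 (badPairs T I J y (g * g) thr q.1 q.2.1 q.2.2)

/-- Badness is defined by the heights of `T` alone, so the set to be hit is fixed before the random
choice; the `t` trials are independent. -/
lemma prob_not_hitsBadPairs_le {Ω : Type*} [Fintype Ω] [Nonempty Ω] {g t y W : ℕ} (hg : 1 ≤ g)
    (hy : 1 ≤ y) (thr : ℤ) (T : Str m n) (I J : Window n) :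
    prob (fun ω : Fin t → ((Fin g → Fin g) × (Fin g → Fin g)) × Ω =>
      ¬ HitsBadPairs y W thr ω T I J) ≤
      (4 * n + 3) ^ 3 * Real.exp (-(t * (W / (4 * y * g ^ 2)))) := by
  have h1 := prob_exists_le (paramRange n)
    (fun q (ω : Fin t → ((Fin g → Fin g) × (Fin g → Fin g)) × Ω) =>
      W < ∑ p ∈ badPairs T I J y (g * g) thr q.1 q.2.1 q.2.2,
        blockWeight T I J y q.1 q.2.1 q.2.2 p ∧
      ∀ τ, ¬ Hits (ω τ).1 (badPairs T I J y (g * g) thr q.1 q.2.1 q.2.2))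
    (B := Real.exp (-(t * (W / (4 * y * g ^ 2))))) fun q _ => by
      by_cases hW : W < ∑ p ∈ badPairs T I J y (g * g) thr q.1 q.2.1 q.2.2,
        blockWeight T I J y q.1 q.2.1 q.2.2 p
      · have h2 := prob_not_hits_le hg (badPairs T I J y (g * g) thr q.1 q.2.1 q.2.2)
          (by classical exact Finset.filter_subset _ _) (blockWeight T I J y q.1 q.2.1 q.2.2) hy
          (fun a P' _ h => sum_blockWeight_row_le T I J y _ _ _ a P' h)
          (fun b P' _ h => sum_blockWeight_col_le T I J y _ _ _ b P' h) hW.le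
        simp only [hW, true_and]
        rw [prob_forall (fun (_ : Fin t) (u : ((Fin g → Fin g) × (Fin g → Fin g)) × Ω) =>
          ¬ Hits u.1 (badPairs T I J y (g * g) thr q.1 q.2.1 q.2.2)), prob_fst (fun u =>
          ¬ Hits u (badPairs T I J y (g * g) thr q.1 q.2.1 q.2.2))]
        rw [Finset.prod_const, Finset.card_univ, Fintype.card_fin, ← mul_neg, Real.exp_nat_mul]
        exact pow_le_pow_left₀ (prob_nonneg _) h2 t
      · refine le_trans (prob_eq_zero fun ω h => hW h.1).le (Real.exp_pos _).le
  rw [card_paramRange] at h1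
  push_cast at h1
  refine (prob_mono fun ω h => ?_).trans h1
  unfold HitsBadPairs at h
  push Not at h
  obtain ⟨q, h2, h3, h4⟩ := h
  exact ⟨q, h2, h3, h4⟩

/-- A sampler for windows of length at most `y` yields one for windows of length at most `x`. -/
lemma HasSampler.step {x y g s t W : ℕ} {l : ℤ} {η B e : ℝ} (hsub : HasSampler m n y l η B)
    (hx : 1 ≤ x) (hs : 1 ≤ s) (hg : 1 ≤ g) (hy : 1 ≤ y) (hxy : x ≤ g * g * y) (he : 0 ≤ e)
    (hex : e ≤ x) (hl : 0 ≤ l) :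
    HasSampler m n x (2 * ⌊2 * e⌋ + W + 2 * (g * g) * (l + 14 * ⌊2 * e⌋))
      (2 * ((n + 1) * (2 * Real.exp (-(s * (e / x) ^ 2 / 16)))) +
        (4 * n + 3) ^ 3 * Real.exp (-(t * (W / (4 * y * g ^ 2)))) + t * (g * g * (g * g)) * η)
      (s + t * g * B) := by
  classical
  obtain ⟨Ω, i1, i2, F, G, Good, h1, h2, h3⟩ := hsub
  have hne : Nonempty (Fin g) := ⟨⟨0, hg⟩⟩
  have hne' : Nonempty (Fin x) := ⟨⟨0, hx⟩⟩
  have hE : 0 ≤ ⌊2 * e⌋ := Int.floor_nonneg.mpr (by positivity)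
  have hthr : 0 ≤ l + 14 * ⌊2 * e⌋ := by omega
  set R := Finset.range (g * g)
  refine ⟨(Fin s → Fin x) × (Fin t → ((Fin g → Fin g) × (Fin g → Fin g)) × Ω), inferInstance,
    inferInstance,
    -- Within a trial, all selected blocks of both windows use the same seed of the given sampler,
    -- so that every selected pair is tested.
    fun ω I => sampledPositions ω.1 I ∪ (Finset.univ : Finset (Fin t × Fin g)).biUnion fun u =>
      F (ω.2 u.1).2 (I.block y (u.2 * g + (ω.2 u.1).1.1 u.2)),
    fun ω I => sampledPositions ω.1 I ∪ (Finset.univ : Finset (Fin t × Fin g)).biUnion fun u =>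
      G (ω.2 u.1).2 (I.block y (u.2 * g + (ω.2 u.1).1.2 u.2)),
    -- The given sampler must be good for all pairs of blocks in all trials, since the pair used in
    -- the argument depends on `T` and the trials; this costs the factor `t * g ^ 4`.
    fun ω T I J => WellSampled e ω.1 T I ∧ WellSampled e ω.1 T J ∧
      HitsBadPairs y W (l + 14 * ⌊2 * e⌋) ω.2 T I J ∧
      ∀ v ∈ (Finset.univ : Finset (Fin t)) ×ˢ (R ×ˢ R),
        Good (ω.2 v.1).2 T (I.block y v.2.1) (J.block y v.2.2), ?_, ?_, ?_⟩
  · intro ω I hI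
    have key : ∀ K : Fin t × Fin g → Finset (Fin n), (∀ u, ((K u).card : ℝ) ≤ B) →
        (((sampledPositions ω.1 I ∪ Finset.univ.biUnion K).card : ℕ) : ℝ) ≤ s + t * g * B := by
      intro K hK
      have a1 := (Finset.card_union_le (sampledPositions ω.1 I) (Finset.univ.biUnion K)).trans
        (Nat.add_le_add (card_sampledPositions_le ω.1 I) Finset.card_biUnion_le)
      have a2 : ((∑ u, (K u).card : ℕ) : ℝ) ≤ ∑ _u : Fin t × Fin g, B := by
        push_cast
        exact Finset.sum_le_sum fun u _ => hK u
      rw [Finset.sum_const, Finset.card_univ, Fintype.card_prod, Fintype.card_fin,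
        Fintype.card_fin, nsmul_eq_mul] at a2
      push_cast at a2
      have a3 : (((sampledPositions ω.1 I ∪ Finset.univ.biUnion K).card : ℕ) : ℝ) ≤
          s + ((∑ u, (K u).card : ℕ) : ℝ) := by exact_mod_cast a1
      push_cast at a3
      linarith
    exact ⟨key _ fun u => (h1 _ _ (I.block_length_le y _)).1,
      key _ fun u => (h1 _ _ (I.block_length_le y _)).2⟩
  · intro T I J hI hJ
    have p1 := prob_not_wellSampled_le hx hs T hI he hex
    have p2 := prob_not_wellSampled_le hx hs T hJ he hex
    have p3 := prob_not_hitsBadPairs_le (Ω := Ω) (t := t) (W := W) hg hy (l + 14 * ⌊2 * e⌋) T I J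
    have p4 := prob_exists_le ((Finset.univ : Finset (Fin t)) ×ˢ (R ×ˢ R))
      (fun v (ω : Fin t → ((Fin g → Fin g) × (Fin g → Fin g)) × Ω) =>
        ¬ Good (ω v.1).2 T (I.block y v.2.1) (J.block y v.2.2)) (B := η) fun v _ => by
        rw [prob_eval v.1 (fun u : ((Fin g → Fin g) × (Fin g → Fin g)) × Ω =>
          ¬ Good u.2 T (I.block y v.2.1) (J.block y v.2.2)),
          prob_snd (fun u => ¬ Good u T (I.block y v.2.1) (J.block y v.2.2))]
        exact h2 T _ _ (I.block_length_le y _) (J.block_length_le y _)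
    rw [Finset.card_product, Finset.card_product, Finset.card_range, Finset.card_univ,
      Fintype.card_fin] at p4
    push_cast at p4
    rw [← prob_fst (Ω' := Fin t → ((Fin g → Fin g) × (Fin g → Fin g)) × Ω)] at p1 p2
    rw [← prob_snd (Ω := Fin s → Fin x)] at p3 p4
    have q1 := prob_or_le (fun ω : (Fin s → Fin x) × (Fin t → ((Fin g → Fin g) × (Fin g → Fin g)) × Ω)
      => ¬ WellSampled e ω.1 T I) (fun ω => ¬ WellSampled e ω.1 T J)
    have q2 := prob_or_le (fun ω : (Fin s → Fin x) × (Fin t → ((Fin g → Fin g) × (Fin g → Fin g)) × Ω)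
      => ¬ HitsBadPairs y W (l + 14 * ⌊2 * e⌋) ω.2 T I J)
      (fun ω => ∃ v ∈ (Finset.univ : Finset (Fin t)) ×ˢ (R ×ˢ R),
        ¬ Good (ω.2 v.1).2 T (I.block y v.2.1) (J.block y v.2.2))
    have q3 := prob_or_le (fun ω : (Fin s → Fin x) × (Fin t → ((Fin g → Fin g) × (Fin g → Fin g)) × Ω)
      => ¬ WellSampled e ω.1 T I ∨ ¬ WellSampled e ω.1 T J)
      (fun ω => ¬ HitsBadPairs y W (l + 14 * ⌊2 * e⌋) ω.2 T I J ∨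
        ∃ v ∈ (Finset.univ : Finset (Fin t)) ×ˢ (R ×ˢ R),
        ¬ Good (ω.2 v.1).2 T (I.block y v.2.1) (J.block y v.2.2))
    refine (prob_mono fun ω h => ?_).trans (q3.trans (by linarith))
    by_contra hc
    push Not at hc
    exact h ⟨hc.1.1, hc.1.2, hc.2.1, hc.2.2⟩
  · rintro ω T T' I J hI hJ ⟨g1, g2, g3, g4⟩ ⟨g1', g2', -, g4'⟩ e1 e2
    have cI := heightsClose_of_wellSampled g1 g1' fun i hi => e1 i (Finset.mem_union_left _ hi)
    have cJ := heightsClose_of_wellSampled g2 g2' fun i hi => e2 i (Finset.mem_union_left _ hi)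
    have hpos : 0 ≤ 2 * ((g : ℤ) * g) * (l + 14 * ⌊2 * e⌋) := by positivity
    refine ⟨fun k k1 k2 => (cI k k1 k2).trans (by omega), fun α β s hM => ?_⟩
    by_cases hlt : α < β
    · have hb : |α| ≤ 2 * n + 1 ∧ |β| ≤ 2 * n + 1 ∧ |s| ≤ 2 * n + 1 := hM.param_bounds hlt
      simp only [abs_le] at hb
      have hq : (α, β, s) ∈ paramRange n := by
        simp only [paramRange, Finset.mem_product, Finset.mem_Icc]
        exact hb
      have hlight : ∑ p ∈ badPairs T I J y (g * g) (l + 14 * ⌊2 * e⌋) α β s,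
          blockWeight T I J y α β s p ≤ W := by
        by_contra hc
        -- Heavy bad pairs would include one tested in some trial `τ`; there the full matching of
        -- `T'` on the cell transfers to `T`, contradicting badness.
        obtain ⟨τ, p, hp, ⟨c1, hs1⟩, ⟨c2, hs2⟩⟩ := g3 _ hq (not_le.mp hc)
        obtain ⟨hpR, hbad⟩ := Finset.mem_filter.mp hp
        have hv : (τ, p) ∈ (Finset.univ : Finset (Fin t)) ×ˢ (R ×ˢ R) :=
          Finset.mem_product.mpr ⟨Finset.mem_univ _, hpR⟩
        refine hbad (BlockChain.of_transfer cI cJ hM y p ?_)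
        refine h3 (ω.2 τ).2 T T' _ _ (I.block_length_le y _) (J.block_length_le y _)
          (g4 _ hv) (g4' _ hv) (fun i hi => e1 i (Finset.mem_union_right _ ?_))
          fun i hi => e2 i (Finset.mem_union_right _ ?_)
        · exact Finset.mem_biUnion.mpr ⟨(τ, c1), Finset.mem_univ _, by rw [hs1] at hi; exact hi⟩
        · exact Finset.mem_biUnion.mpr ⟨(τ, c2), Finset.mem_univ _, by rw [hs2] at hi; exact hi⟩
      have := hasChain_of_light_badPairs cI cJ hM (hI.trans hxy) (hJ.trans hxy) hthr (W := W)
        (by exact_mod_cast hlight)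
      push_cast at this
      exact this
    · exact HasChain.of_nonpos (by omega)

end Step

/-! ### Query complexity -/

/-- There are samplers of loss `ε x` with about `ε ^ (-f) * x ^ (1 / 2 + δ)` queries. -/
def Achievable (δ f : ℝ) : Prop :=
  ∃ (C : ℝ) (p : ℕ), 1 ≤ C ∧ ∀ (m n x : ℕ) (ε Λ : ℝ), 1 ≤ x → x ≤ n → 0 < ε → ε ≤ 1 / 30 →
    1 + Real.log n ≤ Λ → HasSampler m n x ⌊ε * x⌋ (Real.exp (-Λ))
      (C * Λ ^ p * (ε ^ (-f) * (x : ℝ) ^ (1 / 2 + δ)))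

lemma hasSampler_of_le {m n x : ℕ} {ε Λ B : ℝ} (hε : 0 < ε) (hB : x ≤ B) :
    HasSampler m n x ⌊ε * x⌋ (Real.exp (-Λ)) B :=
  (HasSampler.trivial m n x).mono (Int.floor_nonneg.mpr (by positivity)) (Real.exp_pos _).le hB

lemma achievable_half : Achievable (1 / 2) 0 := by
  refine ⟨1, 0, le_rfl, fun m n x ε Λ _ _ hε _ _ => hasSampler_of_le hε ?_⟩
  norm_num

/-- The exponent in the failure probability of the height estimates. -/
lemma sample_exponent_bound {x y g s : ℕ} {Λ ε G e : ℝ} (hΛ : 1 ≤ Λ) (hx : 1 ≤ x) (hy : 1 ≤ y)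
    (hε : 0 < ε) (hG : 1 ≤ G) (hgG : (g : ℝ) ≤ 2 * G) (hxy : (x : ℝ) ≤ g ^ 2 * y)
    (he : e = ε / 1000 * y) (hs : 1792000000 * Λ * (G ^ 4 / ε ^ 2) ≤ s) :
    7 * Λ ≤ s * (e / x) ^ 2 / 16 := by
  have hx0 : (1 : ℝ) ≤ x := by exact_mod_cast hx
  have hy0 : (1 : ℝ) ≤ y := by exact_mod_cast hy
  have h1 : ε / 1000 / (4 * G ^ 2) ≤ e / x := by
    rw [he, div_le_div_iff₀ (by positivity) (by positivity)]
    have h2 : (g : ℝ) ^ 2 ≤ 4 * G ^ 2 := by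
      calc (g : ℝ) ^ 2 ≤ (2 * G) ^ 2 := by gcongr
        _ = 4 * G ^ 2 := by ring
    have h3 : (x : ℝ) ≤ 4 * G ^ 2 * y := hxy.trans (by gcongr)
    calc ε / 1000 * x ≤ ε / 1000 * (4 * G ^ 2 * y) := by gcongr
      _ = _ := by ring
  have h4 : (ε / 1000 / (4 * G ^ 2)) ^ 2 ≤ (e / x) ^ 2 := by gcongr
  -- The constant is `112 * 16 * 1000 ^ 2`; the final division by `16` leaves `7 * Λ`.
  have h5 : 1792000000 * Λ * (G ^ 4 / ε ^ 2) * (ε / 1000 / (4 * G ^ 2)) ^ 2 = 112 * Λ := by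
    field_simp
    norm_num
  have h6 : 1792000000 * Λ * (G ^ 4 / ε ^ 2) * (ε / 1000 / (4 * G ^ 2)) ^ 2 ≤ s * (e / x) ^ 2 :=
    mul_le_mul hs h4 (by positivity) (by positivity)
  rw [h5] at h6
  linarith

/-- The exponent in the failure probability of the trials. -/
lemma trial_exponent_bound {x y g t W : ℕ} {Λ ε : ℝ} (hΛ : 1 ≤ Λ) (hg : 1 ≤ g) (hy : 1 ≤ y)
    (hε : 0 < ε) (hgy : (g : ℝ) ^ 2 * y ≤ 8 * x) (hW : ε * x / 4 ≤ W)
    (ht : 1920 * Λ / ε ≤ t) : 15 * Λ ≤ t * (W / (4 * y * g ^ 2)) := by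
  have hy0 : (1 : ℝ) ≤ y := by exact_mod_cast hy
  have hg0 : (1 : ℝ) ≤ g := by exact_mod_cast hg
  have h1 : ε / 128 ≤ W / (4 * y * g ^ 2) := by
    rw [div_le_div_iff₀ (by norm_num) (by positivity)]
    have : ε * (4 * y * g ^ 2) ≤ ε * (32 * x) := by
      gcongr ε * ?_
      linarith
    linarith
  have h2 : 1920 * Λ / ε * (ε / 128) = 15 * Λ := by field_simp; norm_num
  rw [← h2]
  exact mul_le_mul ht h1 (by positivity) (by positivity)

/-- The failure probability in one step. -/
lemma failure_bound {n x g t : ℕ} {Λ ε G a b : ℝ} (hn : (n : ℝ) ≤ Real.exp Λ) (hΛ : 1 ≤ Λ)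
    (hx : 1 ≤ x) (hxn : x ≤ n) (hε : 0 < ε) (hεx : 1 / ε ≤ x)
    (hG : 1 ≤ G) (hGx : G ^ 2 ≤ x) (hgG : g ≤ 2 * G)
    (ha : 7 * Λ ≤ a) (hb : 15 * Λ ≤ b) (ht' : t ≤ 1921 * Λ / ε) :
    2 * ((n + 1) * (2 * Real.exp (-a))) + (4 * n + 3) ^ 3 * Real.exp (-b) +
        t * (g * g * (g * g)) * Real.exp (-(22 * Λ)) ≤ Real.exp (-Λ) := by
  have hn0 : (1 : ℝ) ≤ n := by exact_mod_cast hx.trans hxn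
  have hxn0 : (x : ℝ) ≤ n := by exact_mod_cast hxn
  -- All quantities are compared with powers of `X`, which is at least `2`, `Λ`, `n`, `1 / ε` and `G
  -- ^ 2`. Each of the three terms is at most a third of `1 / X`.
  obtain ⟨X, hX⟩ : ∃ X, X = Real.exp Λ := ⟨_, rfl⟩
  have hX2 : 2 ≤ X := by linarith [Real.add_one_le_exp Λ]
  have hΛX : Λ ≤ X := by linarith [Real.add_one_le_exp Λ]
  have hexp : ∀ k : ℕ, Real.exp (-(k * Λ)) = (X ^ k)⁻¹ := fun k => by
    rw [Real.exp_neg, Real.exp_nat_mul, hX]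
  have e1 : Real.exp (-a) ≤ (X ^ 7)⁻¹ := by
    rw [← hexp]
    exact Real.exp_le_exp.mpr (by push_cast; linarith)
  have e2 : Real.exp (-b) ≤ (X ^ 15)⁻¹ := by
    rw [← hexp]
    exact Real.exp_le_exp.mpr (by push_cast; linarith)
  have e3 : Real.exp (-(22 * Λ)) = (X ^ 22)⁻¹ := by exact_mod_cast hexp 22
  have e4 : Real.exp (-Λ) = X⁻¹ := by rw [Real.exp_neg, hX]
  rw [← hX] at hn
  rw [e3, e4]
  have hX0 : 0 < X := by linarith
  have inv_le : ∀ (c : ℝ) (k : ℕ), 3 * c ≤ 2 ^ k → c / X ^ (k + 1) ≤ X⁻¹ / 3 := fun c k hc => by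
    have h1 : (2 : ℝ) ^ k ≤ X ^ k := by gcongr
    rw [inv_eq_one_div, div_div, div_le_div_iff₀ (by positivity) (by positivity), pow_succ]
    have := mul_le_mul_of_nonneg_right (hc.trans h1) hX0.le
    linarith
  have f1 : 2 * ((n + 1) * (2 * Real.exp (-a))) ≤ X⁻¹ / 3 := by
    calc 2 * ((n + 1) * (2 * Real.exp (-a))) ≤ 2 * ((X + X) * (2 * (X ^ 7)⁻¹)) := by
          gcongr
          linarith
      _ = 8 / X ^ (5 + 1) := by field_simp; ring
      _ ≤ X⁻¹ / 3 := inv_le _ _ (by norm_num)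
  have f2 : (4 * n + 3) ^ 3 * Real.exp (-b) ≤ X⁻¹ / 3 := by
    calc (4 * n + 3 : ℝ) ^ 3 * Real.exp (-b) ≤ (7 * X) ^ 3 * (X ^ 15)⁻¹ := by
          gcongr
          linarith
      _ = 343 / X ^ (11 + 1) := by field_simp; ring
      _ ≤ X⁻¹ / 3 := inv_le _ _ (by norm_num)
  have f3 : t * (g * g * (g * g)) * (X ^ 22)⁻¹ ≤ X⁻¹ / 3 := by
    have h1 : (t : ℝ) ≤ 1921 * X * X := by
      calc (t : ℝ) ≤ 1921 * Λ * (1 / ε) := by rw [mul_one_div]; exact ht'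
        _ ≤ 1921 * X * X := by
          gcongr
          linarith
    have h3 : (g : ℝ) * g ≤ 4 * X := by
      calc (g : ℝ) * g ≤ (2 * G) * (2 * G) := by gcongr
        _ = 4 * G ^ 2 := by ring
        _ ≤ 4 * X := by linarith
    calc t * (g * g * (g * g)) * (X ^ 22)⁻¹ ≤
        (1921 * X * X) * ((4 * X) * (4 * X)) * (X ^ 22)⁻¹ := by gcongr
      _ = 30736 / X ^ (17 + 1) := by field_simp; ring
      _ ≤ X⁻¹ / 3 := inv_le _ _ (by norm_num)
  linarith

/-- The loss in one step. -/
lemma loss_bound {x y g W : ℕ} {ε : ℝ} (hε : 0 < ε) (hg : 1 ≤ g)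
    (hgy : (g : ℝ) ^ 2 * y ≤ 8 * x) (hW : (W : ℝ) ≤ ε * x / 2) :
    2 * ⌊2 * (ε / 1000 * y)⌋ + W + 2 * (g * g) * (⌊ε / 1000 * y⌋ + 14 * ⌊2 * (ε / 1000 * y)⌋) ≤
      ⌊ε * x⌋ := by
  have hg0 : (1 : ℝ) ≤ g := by exact_mod_cast hg
  rw [Int.le_floor]
  push_cast
  have h1 := Int.floor_le (2 * (ε / 1000 * y))
  have h2 := Int.floor_le (ε / 1000 * y)
  have h3 : ε / 1000 * (g ^ 2 * y) ≤ ε / 1000 * (8 * x) := by gcongr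
  have h4 : ε / 1000 * y ≤ ε / 1000 * (g ^ 2 * y) := by
    gcongr
    have : (1 : ℝ) ≤ g ^ 2 := one_le_pow₀ hg0
    nlinarith [show (0 : ℝ) ≤ y by positivity]
  have h5 : 2 * ((g : ℝ) * g) * (⌊ε / 1000 * y⌋ + 14 * ⌊2 * (ε / 1000 * y)⌋) ≤
      2 * ((g : ℝ) * g) * (29 * (ε / 1000 * y)) := by
    gcongr
    linarith
  -- In units of `ε * x`, the terms are at most `32 / 1000`, `1 / 2` and `2 * 29 * 8 / 1000 = 464 /
  -- 1000`, which sum to `996 / 1000`.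
  nlinarith

set_option maxHeartbeats 1600000 in
/-- One step of the recursion, with `x = exp u` and `ε = exp (-v)`; the windows are cut into about
`exp (2 w)` blocks. -/
lemma Achievable.step {δ f δ' f' : ℝ} (h : Achievable δ f) (hδ0 : 0 ≤ 1 / 2 + δ)
    (hδ1 : 1 / 2 + δ ≤ 1)
    (hw : ∀ u v : ℝ, 0 ≤ u → 0 < v → (1 / 2 + δ') * u + f' * v < u → ∃ w, 0 ≤ w ∧ 2 * w ≤ u ∧
      2 * v ≤ u ∧ 4 * w + 2 * v ≤ (1 / 2 + δ') * u + f' * v ∧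
      (1 + f) * v + w + (u - 2 * w) * (1 / 2 + δ) ≤ (1 / 2 + δ') * u + f' * v) :
    Achievable δ' f' := by
  obtain ⟨C, p, hC, hsub⟩ := h
  set D : ℝ := 7684 * C * 22 ^ p * 1000 ^ f with hD
  have hD0 : 0 ≤ D := by positivity
  refine ⟨1792000001 + D, p + 1, by linarith, fun m n x ε Λ hx hxn hε hε1 hΛ => ?_⟩
  have hx0 : (1 : ℝ) ≤ x := by exact_mod_cast hx
  have hn0 : (1 : ℝ) ≤ n := by exact_mod_cast hx.trans hxn
  have hΛ1 : 1 ≤ Λ := by linarith [Real.log_nonneg hn0]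
  set R := ε ^ (-f') * (x : ℝ) ^ (1 / 2 + δ') with hR
  have hR0 : 0 ≤ R := by positivity
  -- If the claimed bound is at least `x`, everything may be read. Otherwise `R < x` supplies the
  -- last premise of `hw`.
  rcases le_or_gt (x : ℝ) R with hRx | hRx
  · apply hasSampler_of_le hε
    have h1 : (1 : ℝ) ≤ Λ ^ (p + 1) := one_le_pow₀ hΛ1
    calc (x : ℝ) ≤ R := hRx
      _ ≤ ((1792000001 + D) * Λ ^ (p + 1)) * R := by
        apply le_mul_of_one_le_left hR0
        nlinarith
  set u := Real.log x with hu
  set v := -Real.log ε with hv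
  have hu0 : 0 ≤ u := Real.log_nonneg hx0
  have hv0 : 0 < v := by
    have := Real.log_neg hε (by linarith)
    linarith
  have hxu : (x : ℝ) = Real.exp u := (Real.exp_log (by linarith)).symm
  have hεv : ε = Real.exp (-v) := by rw [hv, neg_neg, Real.exp_log hε]
  have hRe : R = Real.exp ((1 / 2 + δ') * u + f' * v) := by
    rw [hR, hxu, hεv, ← Real.exp_mul, ← Real.exp_mul, ← Real.exp_add]
    ring_nf
  obtain ⟨w, w1, w2, w3, w4, w5⟩ := hw u v hu0 hv0 (by
    rw [hRe, hxu] at hRx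
    exact Real.exp_lt_exp.mp hRx)
  set G := Real.exp w with hG
  have hG1 : 1 ≤ G := Real.one_le_exp w1
  have hGx : G ^ 2 ≤ x := by
    rw [hG, hxu, ← Real.exp_nat_mul]
    exact Real.exp_le_exp.mpr (by push_cast; linarith)
  have hεx : 1 / ε ^ 2 ≤ x := by
    rw [hεv, hxu, ← Real.exp_nat_mul, one_div, ← Real.exp_neg]
    exact Real.exp_le_exp.mpr (by push_cast; linarith)
  have hG4 : G ^ 4 / ε ^ 2 ≤ R := by
    rw [hG, hRe, hεv, ← Real.exp_nat_mul, ← Real.exp_nat_mul, ← Real.exp_sub]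
    exact Real.exp_le_exp.mpr (by push_cast; linarith)
  have hGR : 1 / ε * G * (ε ^ (-f) * (x / G ^ 2) ^ (1 / 2 + δ)) ≤ R := by
    rw [hG, hRe, hεv, hxu, ← Real.exp_nat_mul, ← Real.exp_sub, ← Real.exp_mul, ← Real.exp_mul,
      one_div, ← Real.exp_neg, ← Real.exp_add, ← Real.exp_add, ← Real.exp_add]
    refine Real.exp_le_exp.mpr (le_trans (le_of_eq ?_) w5)
    push_cast
    ring
  have hε2 : 1 / ε ≤ x := by
    refine le_trans ?_ hεx
    rw [div_le_div_iff₀ hε (by positivity)]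
    nlinarith
  set g := ⌈G⌉₊ with hg
  have hgG : G ≤ g := Nat.le_ceil G
  have hgG2 : (g : ℝ) ≤ 2 * G := by linarith [Nat.ceil_lt_add_one (show 0 ≤ G by linarith)]
  have hg1 : 1 ≤ g := by exact_mod_cast hG1.trans hgG
  have hg0 : (1 : ℝ) ≤ g := by exact_mod_cast hg1
  set y := ⌈(x : ℝ) / g ^ 2⌉₊ with hy
  have hy1 : 1 ≤ y := Nat.one_le_ceil_iff.mpr (by positivity)
  have hyx : (x : ℝ) ≤ g ^ 2 * y := by
    have := Nat.le_ceil ((x : ℝ) / g ^ 2)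
    rw [div_le_iff₀ (by positivity)] at this
    linarith
  have hyG : (y : ℝ) ≤ 2 * (x / G ^ 2) := by
    have h1 := Nat.ceil_lt_add_one (show 0 ≤ (x : ℝ) / g ^ 2 by positivity)
    have h2 : (x : ℝ) / g ^ 2 ≤ x / G ^ 2 := by gcongr
    have h3 : 1 ≤ (x : ℝ) / G ^ 2 := by rwa [le_div_iff₀ (by positivity), one_mul]
    linarith
  have hyx' : y ≤ x := by
    refine Nat.ceil_le.mpr (div_le_self (by linarith) (one_le_pow₀ hg0))
  have hgy : (g : ℝ) ^ 2 * y ≤ 8 * x := by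
    calc (g : ℝ) ^ 2 * (y : ℝ) ≤ (2 * G) ^ 2 * (2 * (x / G ^ 2)) := by gcongr
      _ = 8 * (x : ℝ) := by field_simp; norm_num
  set W := ⌊ε * x / 2⌋₊ with hW
  have hW1 : (W : ℝ) ≤ ε * x / 2 := Nat.floor_le (by positivity)
  -- From `2 * v ≤ u` and `ε ≤ 1 / 30` follows `ε * x ≥ 30`, so rounding down costs at most half.
  have hW2 : ε * x / 4 ≤ W := by
    have h1 := Nat.lt_floor_add_one (ε * x / 2)
    have h2 : 30 ≤ ε * x := by
      have h3 : 1 / ε ≤ ε * x := by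
        calc 1 / ε = ε * (1 / ε ^ 2) := by field_simp
          _ ≤ ε * x := by gcongr
      have h4 : 30 ≤ 1 / ε := by rw [le_div_iff₀ hε]; linarith
      linarith
    linarith
  set s := ⌈1792000000 * Λ * (G ^ 4 / ε ^ 2)⌉₊ with hs
  have hGε : 1 ≤ G ^ 4 / ε ^ 2 := by
    rw [le_div_iff₀ (by positivity), one_mul]
    have h1 : 1 ≤ G ^ 4 := one_le_pow₀ hG1
    nlinarith
  have hs1 : 1 ≤ s := Nat.one_le_ceil_iff.mpr (by positivity)
  have hsR : (s : ℝ) ≤ 1792000001 * Λ * R := by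
    have h1 := Nat.ceil_lt_add_one (show 0 ≤ 1792000000 * Λ * (G ^ 4 / ε ^ 2) by positivity)
    have h2 : 1 ≤ Λ * (G ^ 4 / ε ^ 2) := one_le_mul_of_one_le_of_one_le hΛ1 hGε
    calc (s : ℝ) ≤ 1792000001 * (Λ * (G ^ 4 / ε ^ 2)) := by linarith
      _ ≤ 1792000001 * (Λ * R) := by gcongr
      _ = _ := by ring
  set t := ⌈1920 * Λ / ε⌉₊ with ht
  have ht2 : (t : ℝ) ≤ 1921 * Λ / ε := by
    have h1 := Nat.ceil_lt_add_one (show 0 ≤ 1920 * Λ / ε by positivity)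
    have h2 : 1 ≤ Λ / ε := by
      rw [le_div_iff₀ hε]
      linarith
    have h3 : 1921 * Λ / ε = 1920 * Λ / ε + Λ / ε := by ring
    linarith
  have hyn : y ≤ n := hyx'.trans hxn
  -- The accuracy `ε / 1000` absorbs the `2 * g ^ 2` losses on cells, and the failure probability
  -- `exp (-(22 * Λ))` the union bound over all pairs and trials.
  have hstep := HasSampler.step (x := x) (g := g) (s := s) (t := t) (W := W)
    (e := ε / 1000 * y)
    (hsub m n y (ε / 1000) (22 * Λ) hy1 hyn (by positivity) (by linarith) (by linarith))
    hx hs1 hg1 hy1 (by rw [← pow_two]; exact_mod_cast hyx) (by positivity)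
    (by
      have : (y : ℝ) ≤ x := by exact_mod_cast hyx'
      calc ε / 1000 * y ≤ 1 * x := by gcongr; linarith
        _ = x := one_mul _)
    (Int.floor_nonneg.mpr (by positivity))
  refine hstep.mono (loss_bound hε hg1 hgy hW1) ?_ ?_
  · refine failure_bound ?_ hΛ1 hx hxn hε hε2 hG1 hGx hgG2
      (sample_exponent_bound hΛ1 hx hy1 hε hG1 hgG2 hyx rfl (Nat.le_ceil _))
      (trial_exponent_bound hΛ1 hg1 hy1 hε hgy hW2 (Nat.le_ceil _)) ht2
    rw [← Real.exp_log (show (0 : ℝ) < n by linarith)]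
    exact Real.exp_le_exp.mpr (by linarith)
  · have hyp : (y : ℝ) ^ (1 / 2 + δ) ≤ 2 * (x / G ^ 2) ^ (1 / 2 + δ) := by
      calc (y : ℝ) ^ (1 / 2 + δ) ≤ (2 * (x / G ^ 2)) ^ (1 / 2 + δ) :=
            Real.rpow_le_rpow (by positivity) hyG hδ0
        _ = 2 ^ (1 / 2 + δ) * (x / G ^ 2) ^ (1 / 2 + δ) :=
            Real.mul_rpow (by norm_num) (by positivity)
        _ ≤ 2 * (x / G ^ 2) ^ (1 / 2 + δ) := by
            gcongr
            calc (2 : ℝ) ^ (1 / 2 + δ) ≤ 2 ^ (1 : ℝ) :=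
                  Real.rpow_le_rpow_of_exponent_le (by norm_num) hδ1
              _ = 2 := Real.rpow_one _
    have hεf : (ε / 1000) ^ (-f) = 1000 ^ f * ε ^ (-f) := by
      rw [Real.div_rpow hε.le (by norm_num), Real.rpow_neg (by norm_num : (0 : ℝ) ≤ 1000)]
      field_simp
    have h1 : (t : ℝ) * g * (C * (22 * Λ) ^ p * ((ε / 1000) ^ (-f) * (y : ℝ) ^ (1 / 2 + δ))) ≤
        D * Λ ^ (p + 1) * R := by
      rw [hεf]
      calc (t : ℝ) * g * (C * (22 * Λ) ^ p * (1000 ^ f * ε ^ (-f) * (y : ℝ) ^ (1 / 2 + δ))) ≤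
          (1921 * Λ / ε) * (2 * G) *
            (C * (22 * Λ) ^ p * (1000 ^ f * ε ^ (-f) * (2 * (x / G ^ 2) ^ (1 / 2 + δ)))) := by
            gcongr
        _ = D * Λ ^ (p + 1) * (1 / ε * G * (ε ^ (-f) * (x / G ^ 2) ^ (1 / 2 + δ))) := by
            rw [hD, mul_pow, pow_succ]
            ring
        _ ≤ D * Λ ^ (p + 1) * R := by gcongr
    have h2 : 1792000001 * Λ * R ≤ 1792000001 * Λ ^ (p + 1) * R := by
      gcongr
      exact le_self_pow₀ hΛ1 (by omega)
    calc (s : ℝ) + t * g * (C * (22 * Λ) ^ p * ((ε / 1000) ^ (-f) * (y : ℝ) ^ (1 / 2 + δ))) ≤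
        1792000001 * Λ ^ (p + 1) * R + D * Λ ^ (p + 1) * R := by linarith
      _ = _ := by ring

/-! ### The exponents -/

/-- The exponent of `1 / ε` in the number of queries. -/
noncomputable def epsExponent (δ : ℝ) : ℝ := 4 * (2 * δ) ^ (1 / Real.logb 2 (3 / 4 : ℝ)) - 4

lemma logb_three_fourths : Real.logb 2 (3 / 4 : ℝ) < 0 ∧ -(1 / 2) ≤ Real.logb 2 (3 / 4 : ℝ) := by
  constructor
  · exact Real.logb_neg (by norm_num) (by norm_num) (by norm_num)
  · have h1 : Real.logb 2 (1 / 2 : ℝ) ≤ Real.logb 2 ((3 / 4 : ℝ) ^ 2) :=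
      Real.logb_le_logb_of_le (by norm_num) (by norm_num) (by norm_num)
    rw [Real.logb_pow, one_div, Real.logb_inv, Real.logb_self_eq_one (by norm_num)] at h1
    push_cast at h1
    linarith

lemma inv_logb_le : 1 / Real.logb 2 (3 / 4 : ℝ) ≤ -2 := by
  obtain ⟨h1, h2⟩ := logb_three_fourths
  rw [div_le_iff_of_neg h1]
  linarith

lemma three_fourths_rpow : (3 / 4 : ℝ) ^ (1 / Real.logb 2 (3 / 4 : ℝ)) = 2 := by
  rw [one_div, Real.inv_logb, Real.rpow_logb (by norm_num) (by norm_num) (by norm_num)]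

/-- The power `1 / logb 2 (3 / 4)` is the one that sends `3 / 4` to `2`, and `-4` is the fixed point
of `f ↦ 2 * f + 4`. -/
lemma epsExponent_step {δ : ℝ} (hδ : 0 < δ) : epsExponent (3 / 4 * δ) = 2 * epsExponent δ + 4 := by
  unfold epsExponent
  rw [show 2 * (3 / 4 * δ) = 3 / 4 * (2 * δ) by ring, Real.mul_rpow (by norm_num) (by linarith),
    three_fourths_rpow]
  ring

/-- Since the power is at most `-2` and `2 * δ ≤ 1`, it is enough that `(2 * δ) ^ (-2)` is at least
`1 + 2 * (1 - 2 * δ)`. The bound yields `16 * v ≤ u` in the base case. -/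
lemma le_epsExponent {δ : ℝ} (hδ : 0 < δ) (hδ' : δ ≤ 1 / 2) : 8 * (1 - 2 * δ) ≤ epsExponent δ := by
  have h1 : (2 * δ) ^ (-2 : ℝ) ≤ (2 * δ) ^ (1 / Real.logb 2 (3 / 4 : ℝ)) :=
    Real.rpow_le_rpow_of_exponent_ge (by linarith) (by linarith) inv_logb_le
  have h2 : (2 * δ) ^ (-2 : ℝ) = ((2 * δ) ^ 2)⁻¹ := by
    rw [Real.rpow_neg (by linarith)]
    norm_num
  have h3 : 1 + 2 * (1 - 2 * δ) ≤ ((2 * δ) ^ 2)⁻¹ := by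
    rw [le_inv_comm₀ (by linarith) (by positivity), ← one_div, le_div_iff₀ (by linarith)]
    nlinarith [mul_nonneg (sq_nonneg (1 - 2 * δ)) (show 0 ≤ 1 + 2 * (2 * δ) by linarith)]
  unfold epsExponent
  linarith

lemma achievable_of_ge {δ : ℝ} (h1 : 3 / 8 ≤ δ) (h2 : δ ≤ 1 / 2) :
    Achievable δ (epsExponent δ) := by
  have hf := le_epsExponent (by linarith) h2
  set f := epsExponent δ
  refine achievable_half.step (by norm_num) (by norm_num) fun u v hu hv h => ?_
  have hf0 : 0 ≤ f := le_trans (by linarith) hf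
  have hfv : 0 ≤ f * v := mul_nonneg hf0 hv.le
  have hlt : δ < 1 / 2 := by
    rcases h2.lt_or_eq with h2 | h2
    · exact h2
    · rw [h2] at h
      linarith
  have huv : 16 * v ≤ u := by
    have h3 : 8 * (1 - 2 * δ) * v ≤ f * v := by gcongr
    by_contra hc
    push Not at hc
    nlinarith
  have hδu : 3 / 8 * u ≤ δ * u := by gcongr
  -- This `w` makes the recursive cost `v + w + (u - 2 * w)` equal to the target `(1 / 2 + δ) * u +
  -- f * v`.
  refine ⟨(1 - 2 * δ) / 2 * u + (1 - f) * v, ?_, ?_, ?_, ?_, ?_⟩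
  · linarith
  · linarith
  · linarith
  · linarith
  · linarith

lemma Achievable.three_fourths {δ : ℝ} (hδ : 0 < δ) (hδ' : δ ≤ 1 / 2)
    (h : Achievable δ (epsExponent δ)) : Achievable (3 / 4 * δ) (epsExponent (3 / 4 * δ)) := by
  have hf := le_epsExponent hδ hδ'
  rw [epsExponent_step hδ]
  set f := epsExponent δ
  have hf0 : 0 ≤ f := le_trans (by linarith) hf
  refine h.step (by linarith) (by linarith) fun u v hu hv hlt => ?_
  have hfv : 0 ≤ f * v := mul_nonneg hf0 hv.le
  have hδu : 0 ≤ δ * u := mul_nonneg hδ.le hu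
  -- The gain is `2 * δ * w = δ * u / 4`, and the cost `4 * w = u / 2` of the heights fits the
  -- target.
  exact ⟨u / 8, by linarith, by linarith, by linarith, by linarith, by linarith⟩

theorem achievable {δ : ℝ} (hδ : 0 < δ) (hδ' : δ ≤ 1 / 2) : Achievable δ (epsExponent δ) := by
  obtain ⟨k, hk⟩ := exists_pow_lt_of_lt_one hδ (show (3 / 4 : ℝ) < 1 by norm_num)
  induction k generalizing δ with
  | zero =>
    rw [pow_zero] at hk
    linarith
  | succ k ih =>
    rcases le_or_gt (3 / 8) δ with h | h
    · exact achievable_of_ge h hδ'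
    · have h1 := ih (δ := 4 / 3 * δ) (by linarith) (by linarith) (by rw [pow_succ] at hk; linarith)
      have h2 := h1.three_fourths (by linarith) (by linarith)
      rwa [show 3 / 4 * (4 / 3 * δ) = δ by ring] at h2

/-! ### Balanced strings and heights -/

/-- The number of opening minus the number of closing parentheses. -/
def balance (w : List DyckStep) : ℤ := w.count DyckStep.U - w.count DyckStep.D

lemma isD1_iff (w : List DyckStep) : IsD1 w ↔ balance w = 0 ∧ ∀ i, 0 ≤ balance (w.take i) := by
  unfold balance
  constructor
  · rintro ⟨p, rfl⟩
    exact ⟨by rw [p.count_U_eq_count_D]; ring, fun i => by have := p.count_D_le_count_U i; omega⟩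
  · rintro ⟨h1, h2⟩
    exact ⟨⟨w, by omega, fun i => by have := h2 i; omega⟩, rfl⟩

lemma balance_append (v w : List DyckStep) : balance (v ++ w) = balance v + balance w := by
  simp only [balance, List.count_append]
  push_cast
  ring

section Slices

variable {m n : ℕ}

lemma slice_succ (T : Str m n) {a b : ℕ} (h1 : a ≤ b) (h2 : b < n) :
    slice T a (b + 1) = slice T a b ++ [T ⟨b, h2⟩] := by
  unfold slice
  rw [List.take_add_one, List.drop_append_of_le_length (by simp; omega)]
  congr 1
  simp [h2]

lemma balance_slice (T : Str m n) {a b : ℕ} (h1 : a ≤ b) (h2 : b ≤ n) :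
    balance (mu (slice T a b)) = height T b - height T a := by
  induction b, h1 using Nat.le_induction with
  | base => simp [slice, mu, balance]
  | succ b hb ih =>
    have hn : b < n := h2
    rw [slice_succ T hb hn, mu, List.map_append, balance_append, height_succ]
    have h3 := ih hn.le
    unfold mu at h3
    rw [h3]
    have h4 : balance (List.map Prod.fst [T ⟨b, hn⟩]) = stepAt T b := by
      rcases h5 : (T ⟨b, hn⟩).1 <;> simp [balance, stepAt, hn, h5]
    rw [h4]
    ring

lemma take_mu_slice (T : Str m n) (a b i : ℕ) :
    (mu (slice T a b)).take i = mu (slice T a (min (a + i) b)) := by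
  unfold mu slice
  rw [← List.map_take, List.take_drop, List.take_take]

lemma length_slice (T : Str m n) {a b : ℕ} (h2 : b ≤ n) : (slice T a b).length = b - a := by
  simp [slice, h2]

lemma isD1_slice_iff (T : Str m n) {a b : ℕ} (h1 : a ≤ b) (h2 : b ≤ n) :
    IsD1 (mu (slice T a b)) ↔
      height T b = height T a ∧ ∀ k, a ≤ k → k ≤ b → height T a ≤ height T k := by
  rw [isD1_iff, balance_slice T h1 h2]
  refine and_congr (by omega) ⟨fun h k h3 h4 => ?_, fun h i => ?_⟩
  · have := h (k - a)
    rw [take_mu_slice, show min (a + (k - a)) b = k by omega, balance_slice T h3 (h4.trans h2)] at this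
    omega
  · rw [take_mu_slice, balance_slice T (by omega) (by omega)]
    have := h (min (a + i) b) (by omega) (by omega)
    omega

lemma stepAt_of_U {T : Str m n} {i : Fin n} (h : (T i).1 = DyckStep.U) : stepAt T i = 1 := by
  rw [stepAt_val, if_pos h]

lemma stepAt_of_D {T : Str m n} {i : Fin n} (h : (T i).1 = DyckStep.D) : stepAt T i = -1 := by
  rw [stepAt_val, if_neg (by rw [h]; decide)]

lemma eq_U_of_lt {T : Str m n} {i : Fin n} (h : height T i < height T (i + 1)) :
    (T i).1 = DyckStep.U := by
  rcases DyckStep.dichotomy (T i).1 with h1 | h1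
  · exact h1
  · rw [height_succ, stepAt_of_D h1] at h
    omega

lemma eq_D_of_lt {T : Str m n} {i : Fin n} (h : height T (i + 1) < height T i) :
    (T i).1 = DyckStep.D := by
  rcases DyckStep.dichotomy (T i).1 with h1 | h1
  · rw [height_succ, stepAt_of_U h1] at h
    omega
  · exact h1

lemma partners_iff (T : Str m n) {i j : Fin n} (hij : i < j) :
    Partners T i j ↔ (T i).1 = DyckStep.U ∧ (T j).1 = DyckStep.D ∧ height T (j + 1) = height T i ∧
      ∀ k : ℕ, (i : ℕ) < k → k ≤ j → height T i < height T k := by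
  have hij' : (i : ℕ) + 1 ≤ j := hij
  unfold Partners
  rw [isD1_slice_iff T hij' j.2.le]
  simp only [hij, true_and]
  refine and_congr_right fun hi => and_congr_right fun hj => ?_
  have h1 := height_succ T i
  have h2 := height_succ T j
  rw [stepAt_of_U hi] at h1
  rw [stepAt_of_D hj] at h2
  refine and_congr (by omega) (forall_congr' fun k => ?_)
  rw [Nat.succ_le_iff]
  refine forall_congr' fun _ => forall_congr' fun _ => by omega

/-! ### Excess parentheses in terms of heights -/

lemma mem_excessOpen_iff (T : Str m n) (S : Window n) (i : Fin n) :
    i ∈ excessOpen T S ↔ OpenAt T S (height T i - height T S.lo) i := by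
  unfold excessOpen OpenAt
  simp only [Finset.mem_filter, Finset.mem_univ, true_and]
  refine and_congr_right fun h1 => and_congr_right fun h2 => ⟨fun ⟨h3, h4⟩ => ?_, fun h4 => ?_⟩
  · by_contra hc
    -- At the first later `k` where the height is back at that of `i` or below, the position `k - 1`
    -- carries the partner of `i`.
    push Not at hc
    have hex := hc
    classical
    have hspec := Nat.find_spec hex
    have hmin := fun k => @Nat.find_min _ _ hex k
    set k := Nat.find hex
    obtain ⟨k1, k2, k3⟩ := hspec
    have h5 := height_succ T i
    rw [stepAt_of_U h3] at h5
    have k4 : (i : ℕ) + 1 < k := by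
      rcases Nat.lt_or_ge ((i : ℕ) + 1) k with h | h
      · exact h
      · have : k = i + 1 := by omega
        rw [this] at k3
        omega
    have key : ∀ l : ℕ, (i : ℕ) < l → l < k → height T i < height T l := by
      intro l l1 l2
      by_contra hl
      exact hmin l l2 ⟨l1, by omega, by omega⟩
    have hS := S.hi_le
    have hkn : k - 1 < n := by omega
    have h6 := key (k - 1) (by omega) (by omega)
    have h7 := height_step_bounds T (k - 1)
    rw [Nat.sub_add_cancel (by omega)] at h7
    refine h4 ⟨k - 1, hkn⟩ (by simp only; omega) ((partners_iff T (by
      rw [Fin.lt_def]; simp only; omega)).mpr ⟨h3, eq_D_of_lt ?_, ?_, fun l l1 l2 =>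
        key l l1 (by simp only at l2; omega)⟩)
    · simp only [Nat.sub_add_cancel (show 1 ≤ k by omega)]
      omega
    · simp only [Nat.sub_add_cancel (show 1 ≤ k by omega)]
      omega
  · refine ⟨eq_U_of_lt (h4 _ (Nat.lt_succ_self _) h2), fun j hj hp => ?_⟩
    have hlt := hp.1
    have := ((partners_iff T hlt).mp hp).2.2.1
    have := h4 (j + 1) (by have : (i : ℕ) < j := hlt; omega) hj
    omega

lemma mem_excessClose_iff (T : Str m n) (S : Window n) (j : Fin n) :
    j ∈ excessClose T S ↔ CloseAt T S (height T (j + 1) - height T S.lo) j := by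
  unfold excessClose CloseAt
  simp only [Finset.mem_filter, Finset.mem_univ, true_and]
  refine and_congr_right fun h1 => and_congr_right fun h2 => ⟨fun ⟨h3, h4⟩ => ?_, fun h4 => ?_⟩
  · by_contra hc
    push Not at hc
    obtain ⟨k0, k01, k02, k03⟩ := hc
    classical
    -- The last such `k` before `j` is the position of the partner of `j`.
    set P : ℕ → Prop := fun k => S.lo ≤ k ∧ height T k ≤ height T (j + 1)
    have hP : P (Nat.findGreatest P j) := Nat.findGreatest_spec k02 ⟨k01, k03⟩
    have hle : Nat.findGreatest P j ≤ j := Nat.findGreatest_le _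
    have hmax : ∀ l, Nat.findGreatest P j < l → l ≤ j → ¬ P l := fun l =>
      Nat.findGreatest_is_greatest
    set k := Nat.findGreatest P j
    have h5 := height_succ T j
    rw [stepAt_of_D h3] at h5
    have key : ∀ l : ℕ, k < l → l ≤ j → height T (j + 1) < height T l := by
      intro l l1 l2
      by_contra hl
      exact hmax l l1 l2 ⟨hP.1.trans l1.le, by omega⟩
    have k4 : k < j := by
      rcases hle.lt_or_eq with h | h
      · exact h
      · have := hP.2
        rw [h] at this
        omega
    have h6 := key (k + 1) (by omega) (by omega)
    have h7 := height_step_bounds T k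
    have h8 := hP.2
    refine h4 ⟨k, by omega⟩ hP.1 ((partners_iff T (by rw [Fin.lt_def]; exact k4)).mpr
      ⟨eq_U_of_lt (by simp only; omega), h3, by simp only; omega, fun l l1 l2 => ?_⟩)
    have := key l l1 l2
    simp only
    omega
  · refine ⟨eq_D_of_lt (h4 _ h1 le_rfl), fun i hi hp => ?_⟩
    have hlt := hp.1
    have := ((partners_iff T hlt).mp hp).2.2.1
    have := h4 i hi (by have : (i : ℕ) < j := hlt; omega)
    omega

/-- The number of excess opening parentheses in terms of heights. -/
noncomputable def excessHeight (T : Str m n) (S : Window n) : ℤ :=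
  height T S.hi - minOn T S.lo S.hi

lemma balance_take_replicate (s : DyckStep) (k i : ℕ) :
    balance ((List.replicate k s).take i) = (min i k : ℕ) * balance [s] := by
  rw [List.take_replicate]
  rcases s <;> simp [balance, List.count_replicate]

lemma e0_le (T : Str m n) (S : Window n) : (e0 (S.str T) : ℤ) ≤ excessHeight T S := by
  have hlo := minOn_le T le_rfl S.lo_le_hi
  have hhi := minOn_le T S.lo_le_hi le_rfl
  set M := minOn T S.lo S.hi
  have h0 : (0 : ℤ) ≤ height T S.hi - M := by omega
  unfold excessHeight
  rw [← Int.toNat_of_nonneg h0]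
  norm_cast
  apply Nat.sInf_le
  -- With this many opening parentheses in front, the lowest point of the window is at height `0`.
  refine ⟨(height T S.lo - M).toNat, ?_⟩
  set k := (height T S.lo - M).toNat with hk
  set l := (height T S.hi - M).toNat with hl
  have hrep : ∀ (s : DyckStep) (k : ℕ), balance (List.replicate k s) = k * balance [s] := by
    intro s k
    have := balance_take_replicate s k k
    rwa [List.take_of_length_le (by simp), min_self] at this
  have hU : balance [DyckStep.U] = 1 := rfl
  have hD : balance [DyckStep.D] = -1 := rfl
  have hlen : (mu (S.str T)).length = S.hi - S.lo := by
    simp [mu, Window.str, length_slice T S.hi_le]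
  have htot : balance (mu (S.str T)) = height T S.hi - height T S.lo :=
    balance_slice T S.lo_le_hi S.hi_le
  rw [isD1_iff]
  refine ⟨?_, fun i => ?_⟩
  · rw [balance_append, balance_append, hrep, hrep, htot, hU, hD]
    omega
  · rw [List.take_append, List.take_append, balance_append, balance_append,
      balance_take_replicate, balance_take_replicate, hU, hD]
    simp only [List.length_append, List.length_replicate, hlen]
    have hmid : balance ((mu (S.str T)).take (i - k)) =
        height T (min (S.lo + (i - k)) S.hi) - height T S.lo := by
      rw [Window.str, take_mu_slice, balance_slice T]
      · have := S.lo_le_hi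
        omega
      · have := S.hi_le
        omega
    rw [hmid]
    have hlh := S.lo_le_hi
    rcases le_or_gt i k with h | h
    · rw [show i - k = 0 by omega, Nat.add_zero, min_eq_left hlh]
      omega
    · rcases le_or_gt (S.lo + (i - k)) S.hi with h' | h'
      · rw [min_eq_left h']
        have := minOn_le T (show S.lo ≤ S.lo + (i - k) by omega) h'
        omega
      · rw [min_eq_right h'.le]
        omega

lemma excessHeight_le_length (T : Str m n) (S : Window n) : excessHeight T S ≤ S.length := by
  obtain ⟨k, h1, h2, e⟩ := minOn_attained T S.lo_le_hi
  have h3 := height_add_bounds T k (S.hi - k)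
  rw [Nat.add_sub_cancel' h2] at h3
  unfold excessHeight Window.length
  omega

/-! ### The order of excess parentheses -/

lemma OpenAt.lt_of_lt {T : Str m n} {I : Window n} {h h' : ℤ} {i i' : Fin n} (hi : OpenAt T I h i)
    (hi' : OpenAt T I h' i') (hlt : i < i') : h < h' := by
  have := hi.2.2.2 i' hlt hi'.2.1.le
  have := hi.2.2.1
  have := hi'.2.2.1
  omega

lemma CloseAt.lt_of_lt {T : Str m n} {J : Window n} {h h' : ℤ} {j j' : Fin n}
    (hj : CloseAt T J h j) (hj' : CloseAt T J h' j') (hlt : j < j') : h' < h := by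
  have := hj'.2.2.2 (j + 1) (hj.1.trans (Nat.le_succ _)) hlt
  have := hj.2.2.1
  have := hj'.2.2.1
  omega

lemma OpenAt.lt_iff {T : Str m n} {I : Window n} {h h' : ℤ} {i i' : Fin n} (hi : OpenAt T I h i)
    (hi' : OpenAt T I h' i') : i < i' ↔ h < h' := by
  refine ⟨hi.lt_of_lt hi', fun hlt => ?_⟩
  rcases lt_trichotomy i i' with h1 | h1 | h1
  · exact h1
  · subst h1
    have := hi.2.2.1
    have := hi'.2.2.1
    omega
  · have := hi'.lt_of_lt hi h1
    omega

lemma CloseAt.lt_iff {T : Str m n} {J : Window n} {h h' : ℤ} {j j' : Fin n}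
    (hj : CloseAt T J h j) (hj' : CloseAt T J h' j') : j < j' ↔ h' < h := by
  refine ⟨hj.lt_of_lt hj', fun hlt => ?_⟩
  rcases lt_trichotomy j j' with h1 | h1 | h1
  · exact h1
  · subst h1
    have := hj.2.2.1
    have := hj'.2.2.1
    omega
  · have := hj'.lt_of_lt hj h1
    omega

lemma OpenAt.unique {T : Str m n} {I : Window n} {h : ℤ} {i i' : Fin n} (hi : OpenAt T I h i)
    (hi' : OpenAt T I h i') : i = i' := by
  have h1 := hi.lt_iff hi'
  have h2 := hi'.lt_iff hi
  simp only [lt_self_iff_false, iff_false, not_lt] at h1 h2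
  exact le_antisymm h2 h1

/-- Heights change by at most `1`, so the last point at relative height at most `h` has relative
height exactly `h`, and everything after it is higher. -/
lemma exists_openAt (T : Str m n) (I : Window n) {h : ℤ}
    (h1 : minOn T I.lo I.hi - height T I.lo ≤ h) (h2 : h < height T I.hi - height T I.lo) :
    ∃ i, OpenAt T I h i := by
  classical
  obtain ⟨k0, k01, k02, e⟩ := minOn_attained T I.lo_le_hi
  set P : ℕ → Prop := fun k => I.lo ≤ k ∧ height T k - height T I.lo ≤ h
  have hP : P (Nat.findGreatest P I.hi) := Nat.findGreatest_spec k02 ⟨k01, by omega⟩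
  have hle : Nat.findGreatest P I.hi ≤ I.hi := Nat.findGreatest_le _
  have hmax : ∀ l, Nat.findGreatest P I.hi < l → l ≤ I.hi → ¬ P l := fun l =>
    Nat.findGreatest_is_greatest
  set k := Nat.findGreatest P I.hi
  have hk : k < I.hi := by
    rcases hle.lt_or_eq with h | h
    · exact h
    · have := hP.2
      rw [h] at this
      omega
  have key : ∀ l : ℕ, k < l → l ≤ I.hi → h < height T l - height T I.lo := by
    intro l l1 l2
    by_contra hl
    exact hmax l l1 l2 ⟨hP.1.trans l1.le, by omega⟩
  have h3 := key (k + 1) (by omega) (by omega)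
  have h4 := height_step_bounds T k
  have h5 := hP.2
  refine ⟨⟨k, hk.trans_le I.hi_le⟩, hP.1, hk, by simp only; omega, fun l l1 l2 => ?_⟩
  have := key l l1 l2
  simp only
  omega

lemma exists_closeAt (T : Str m n) (J : Window n) {h : ℤ}
    (h1 : minOn T J.lo J.hi - height T J.lo ≤ h) (h2 : h < 0) : ∃ j, CloseAt T J h j := by
  classical
  obtain ⟨k0, k01, k02, e⟩ := minOn_attained T J.lo_le_hi
  have hex : ∃ k, J.lo ≤ k ∧ height T k - height T J.lo ≤ h := ⟨k0, k01, by omega⟩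
  have hspec := Nat.find_spec hex
  have hmin := fun k => @Nat.find_min _ _ hex k
  have hle : Nat.find hex ≤ k0 := Nat.find_min' hex ⟨k01, by omega⟩
  set k := Nat.find hex
  obtain ⟨k1, k2⟩ := hspec
  have hk : J.lo < k := by
    rcases k1.lt_or_eq with h | h
    · exact h
    · rw [← h] at k2
      omega
  have key : ∀ l : ℕ, J.lo ≤ l → l < k → h < height T l - height T J.lo := by
    intro l l1 l2
    by_contra hl
    exact hmin l l2 ⟨l1, by omega⟩
  have h3 := key (k - 1) (by omega) (by omega)
  have h4 := height_step_bounds T (k - 1)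
  have hJ := J.hi_le
  rw [Nat.sub_add_cancel (by omega)] at h4
  refine ⟨⟨k - 1, by omega⟩, by simp only; omega, by simp only; omega, ?_, fun l l1 l2 => ?_⟩
  · simp only [Nat.sub_add_cancel (show 1 ≤ k by omega)]
    omega
  · have := key l l1 (by simp only at l2; omega)
    simp only [Nat.sub_add_cancel (show 1 ≤ k by omega)]
    omega

lemma OpenAt.height_bounds {T : Str m n} {I : Window n} {h : ℤ} {i : Fin n} (hi : OpenAt T I h i) :
    minOn T I.lo I.hi - height T I.lo ≤ h ∧ h < height T I.hi - height T I.lo := by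
  have h1 := minOn_le T hi.1 hi.2.1.le
  have h2 := hi.2.2.2 I.hi hi.2.1 le_rfl
  have h3 := hi.2.2.1
  omega

lemma CloseAt.height_bounds {T : Str m n} {J : Window n} {h : ℤ} {j : Fin n}
    (hj : CloseAt T J h j) : minOn T J.lo J.hi - height T J.lo ≤ h ∧ h < 0 := by
  have h1 := minOn_le T (hj.1.trans (Nat.le_succ _)) hj.2.1
  have h2 := hj.2.2.2 J.lo le_rfl hj.1
  have h3 := hj.2.2.1
  simp only [Nat.succ_eq_add_one] at h1
  omega

lemma OpenAt.mem_excessOpen {T : Str m n} {I : Window n} {h : ℤ} {i : Fin n}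
    (hi : OpenAt T I h i) : i ∈ excessOpen T I := by
  rw [mem_excessOpen_iff, hi.2.2.1]
  exact hi

lemma CloseAt.mem_excessClose {T : Str m n} {J : Window n} {h : ℤ} {j : Fin n}
    (hj : CloseAt T J h j) : j ∈ excessClose T J := by
  rw [mem_excessClose_iff, hj.2.2.1]
  exact hj

lemma excessHeight_le_card (T : Str m n) (S : Window n) :
    excessHeight T S ≤ (excessOpen T S).card := by
  have h1 : Finset.Ico (minOn T S.lo S.hi - height T S.lo) (height T S.hi - height T S.lo) ⊆
      (excessOpen T S).image fun i : Fin n => height T i - height T S.lo := by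
    intro h hh
    obtain ⟨h2, h3⟩ := Finset.mem_Ico.mp hh
    obtain ⟨i, hi⟩ := exists_openAt T S h2 h3
    exact Finset.mem_image.mpr ⟨i, hi.mem_excessOpen, hi.2.2.1⟩
  have h2 := (Finset.card_le_card h1).trans Finset.card_image_le
  rw [Int.card_Ico] at h2
  unfold excessHeight
  omega

/-- A nested matching of contiguous ranges of excess parentheses shifts the heights. -/
lemma exists_fullMatch {T : Str m n} {S₁ S₂ : Window n} {p q : ℕ}
    (h : MatchedInRange T ((excessOpen T S₁).filter fun i : Fin n => p ≤ (i : ℕ) ∧ (i : ℕ) < q) S₂) :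
    ∃ α β s : ℤ, FullMatch T S₁ S₂ α β s ∧
      (((excessOpen T S₁).filter fun i : Fin n => p ≤ (i : ℕ) ∧ (i : ℕ) < q).card : ℤ) ≤ β - α := by
  classical
  obtain ⟨c, d, φ, hbij, hanti, hcomp⟩ := h
  set O := (excessOpen T S₁).filter fun i : Fin n => p ≤ (i : ℕ) ∧ (i : ℕ) < q with hO
  set C := (excessClose T S₂).filter fun j : Fin n => c ≤ (j : ℕ) ∧ (j : ℕ) < d with hC
  rcases O.eq_empty_or_nonempty with hemp | hne
  · exact ⟨0, 0, 0, fun h h1 h2 => by omega, by rw [hemp]; simp⟩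
  set η : Fin n → ℤ := fun i => height T i - height T S₁.lo with hη
  set κ : Fin n → ℤ := fun j => height T (j + 1) - height T S₂.lo with hκ
  have hOpen : ∀ i ∈ O, OpenAt T S₁ (η i) i := fun i hi =>
    (mem_excessOpen_iff T S₁ i).mp (Finset.mem_filter.mp hi).1
  have hClose : ∀ j ∈ C, CloseAt T S₂ (κ j) j := fun j hj =>
    (mem_excessClose_iff T S₂ j).mp (Finset.mem_filter.mp hj).1
  have hφ : ∀ i ∈ O, φ i ∈ C := fun i hi => hbij.mapsTo hi
  obtain ⟨a, ha, hamin⟩ := O.exists_min_image η hne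
  obtain ⟨b, hb, hbmax⟩ := O.exists_max_image η hne
  have hex : ∀ h, η a ≤ h → h ≤ η b → ∃ i ∈ O, η i = h := by
    intro h h1 h2
    have b1 := (hOpen a ha).height_bounds
    have b2 := (hOpen b hb).height_bounds
    obtain ⟨i, hi⟩ := exists_openAt T S₁ (h := h) (by omega) (by omega)
    have c1 := not_congr (hi.lt_iff (hOpen a ha))
    have c2 := not_congr ((hOpen b hb).lt_iff hi)
    have d1 := (Finset.mem_filter.mp ha).2
    have d2 := (Finset.mem_filter.mp hb).2
    simp only [Fin.lt_def] at c1 c2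
    exact ⟨i, Finset.mem_filter.mpr ⟨hi.mem_excessOpen, by omega⟩, hi.2.2.1⟩
  -- A gap between the two images would contain the height of another closing parenthesis in the
  -- range `C`; its partner in `O` would start strictly between `η i` and `η i + 1`.
  have hstep : ∀ i ∈ O, ∀ i' ∈ O, η i' = η i + 1 → κ (φ i') = κ (φ i) + 1 := by
    intro i hi i' hi' he
    have h1 := hClose _ (hφ i hi)
    have h2 := hClose _ (hφ i' hi')
    have hlt : i < i' := ((hOpen i hi).lt_iff (hOpen i' hi')).mpr (by omega)
    have h3 : κ (φ i) < κ (φ i') := (h2.lt_iff h1).mp (hanti hi hi' hlt)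
    by_contra hne'
    have b1 := h1.height_bounds
    have b2 := h2.height_bounds
    obtain ⟨j, hj⟩ := exists_closeAt T S₂ (h := κ (φ i) + 1) (by omega) (by omega)
    have e1 : j < φ i := (hj.lt_iff h1).mpr (by omega)
    have e2 : φ i' < j := (h2.lt_iff hj).mpr (by omega)
    have d1 := (Finset.mem_filter.mp (hφ i hi)).2
    have d2 := (Finset.mem_filter.mp (hφ i' hi')).2
    have hjC : j ∈ C := by
      simp only [Fin.lt_def] at e1 e2
      exact Finset.mem_filter.mpr ⟨hj.mem_excessClose, by omega⟩
    obtain ⟨i₀, hi₀, rfl⟩ := hbij.surjOn hjC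
    have f1 := (hanti.lt_iff_gt hi₀ hi).mp e1
    have f2 := (hanti.lt_iff_gt hi' hi₀).mp e2
    have g1 := ((hOpen i hi).lt_iff (hOpen i₀ hi₀)).mp f1
    have g2 := ((hOpen i₀ hi₀).lt_iff (hOpen i' hi')).mp f2
    omega
  have hshift : ∀ l : ℕ, ∀ i ∈ O, η i = η a + l → κ (φ i) = κ (φ a) + l := by
    intro l
    induction l with
    | zero =>
      intro i hi he
      have h1 := hOpen i hi
      rw [he, Nat.cast_zero, add_zero] at h1
      rw [h1.unique (hOpen a ha)]
      simp
    | succ l ih =>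
      intro i hi he
      have := hbmax i hi
      obtain ⟨i', hi', he'⟩ := hex (η a + l) (by omega) (by push_cast at he; omega)
      have h1 := ih i' hi' he'
      have h2 := hstep i' hi' i hi (by push_cast at he; omega)
      push_cast
      omega
  refine ⟨η a, η b + 1, κ (φ a) - η a, fun h h1 h2 => ?_, ?_⟩
  · obtain ⟨i, hi, he⟩ := hex h h1 (by omega)
    have h3 := hshift (h - η a).toNat i hi (by omega)
    refine ⟨i, φ i, he ▸ hOpen i hi, ?_, hcomp i hi⟩
    have h4 : h + (κ (φ a) - η a) = κ (φ i) := by omega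
    rw [h4]
    exact hClose _ (hφ i hi)
  · have h1 : O.card ≤ (Finset.Ico (η a) (η b + 1)).card := by
      refine Finset.card_le_card_of_injOn η (fun i hi => ?_) fun i hi i' hi' he => ?_
      · have := hamin i hi
        have := hbmax i hi
        simp only [Finset.coe_Ico, Set.mem_Ico]
        omega
      · have h2 := hOpen i hi
        rw [he] at h2
        exact h2.unique (hOpen i' hi')
    rw [Int.card_Ico] at h1
    have := hamin b hb
    omega

lemma EpsMatch.exists_fullMatch {T : Str m n} {ε : ℝ} {x : ℕ} {S₁ S₂ : Window n}
    (h : EpsMatch T ε x S₁ S₂) :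
    ∃ α β s : ℤ, FullMatch T S₁ S₂ α β s ∧
      (excessHeight T S₁ : ℝ) - 12 * ε * x ≤ ((β - α : ℤ) : ℝ) := by
  classical
  obtain ⟨p, q, h1, h2, h3⟩ := h
  obtain ⟨α, β, s, h4, h5⟩ := SubstringMatching.exists_fullMatch h3
  refine ⟨α, β, s, h4, ?_⟩
  have h6 := excessHeight_le_card T S₁
  have h7 : excessOpen T S₁ ⊆ ((excessOpen T S₁).filter fun i : Fin n => (i : ℕ) < p) ∪
      (((excessOpen T S₁).filter fun i : Fin n => p ≤ (i : ℕ) ∧ (i : ℕ) < q) ∪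
        ((excessOpen T S₁).filter fun i : Fin n => q ≤ (i : ℕ))) := by
    intro i hi
    simp only [Finset.mem_union, Finset.mem_filter, hi, true_and]
    omega
  have h8 := (Finset.card_le_card h7).trans ((Finset.card_union_le _ _).trans
    (Nat.add_le_add_left (Finset.card_union_le _ _) _))
  have h9 : (excessHeight T S₁ : ℝ) ≤ ((excessOpen T S₁).card : ℝ) := by exact_mod_cast h6
  have h10 : ((excessOpen T S₁).card : ℝ) ≤
      (((excessOpen T S₁).filter fun i : Fin n => (i : ℕ) < p).card : ℝ) +
      ((((excessOpen T S₁).filter fun i : Fin n => p ≤ (i : ℕ) ∧ (i : ℕ) < q).card : ℝ) +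
      (((excessOpen T S₁).filter fun i : Fin n => q ≤ (i : ℕ)).card : ℝ)) := by exact_mod_cast h8
  have h11 : (((excessOpen T S₁).filter fun i : Fin n => p ≤ (i : ℕ) ∧ (i : ℕ) < q).card : ℝ) ≤
      ((β - α : ℤ) : ℝ) := by exact_mod_cast h5
  linarith

/-- A chain of heights is a nested matching of subsequences. -/
lemma HasChain.exists_nestedMatching {T : Str m n} {S₁ S₂ : Window n} {α β s l : ℤ}
    (h : HasChain (HeightRel T S₁ S₂) α β s l) :
    ∃ O C : Finset (Fin n), O ⊆ excessOpen T S₁ ∧ C ⊆ excessClose T S₂ ∧ NestedMatching T O C ∧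
      l ≤ O.card := by
  classical
  obtain ⟨S, hS, hr, hl⟩ := h
  have hr' : ∀ p : {p // p ∈ S}, HeightRel T S₁ S₂ p.1.1 p.1.2 := fun p => (hr p.1 p.2).1
  choose i j hi hj hc using hr'
  have hinj : Function.Injective i := by
    intro p q hpq
    apply Subtype.ext
    apply hS.injOn_fst p.2 q.2
    have h1 := (hi p).2.2.1
    have h2 := (hi q).2.2.1
    rw [hpq] at h1
    omega
  have hext : ∀ p, Function.extend i j id (i p) = j p := fun p => hinj.extend_apply j id p
  refine ⟨Finset.univ.image i, Finset.univ.image j, ?_, ?_,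
    ⟨Function.extend i j id, ⟨?_, ?_, ?_⟩, ?_, ?_⟩, ?_⟩
  · intro a ha
    obtain ⟨p, -, rfl⟩ := Finset.mem_image.mp ha
    exact (hi p).mem_excessOpen
  · intro a ha
    obtain ⟨p, -, rfl⟩ := Finset.mem_image.mp ha
    exact (hj p).mem_excessClose
  · intro a ha
    obtain ⟨p, -, rfl⟩ := Finset.mem_image.mp (Finset.mem_coe.mp ha)
    rw [hext]
    exact Finset.mem_coe.mpr (Finset.mem_image_of_mem _ (Finset.mem_univ _))
  · intro a ha b hb hab
    obtain ⟨p, -, rfl⟩ := Finset.mem_image.mp (Finset.mem_coe.mp ha)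
    obtain ⟨q, -, rfl⟩ := Finset.mem_image.mp (Finset.mem_coe.mp hb)
    rw [hext, hext] at hab
    congr 1
    apply Subtype.ext
    apply hS.injOn_snd p.2 q.2
    have h1 := (hj p).2.2.1
    have h2 := (hj q).2.2.1
    rw [hab] at h1
    omega
  · intro b hb
    obtain ⟨p, -, rfl⟩ := Finset.mem_image.mp (Finset.mem_coe.mp hb)
    exact ⟨i p, Finset.mem_coe.mpr (Finset.mem_image_of_mem _ (Finset.mem_univ _)), hext p⟩
  · intro a ha b hb hab
    obtain ⟨p, -, rfl⟩ := Finset.mem_image.mp (Finset.mem_coe.mp ha)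
    obtain ⟨q, -, rfl⟩ := Finset.mem_image.mp (Finset.mem_coe.mp hb)
    rw [hext, hext, (hj q).lt_iff (hj p), ← hS p.1 p.2 q.1 q.2]
    exact ((hi p).lt_iff (hi q)).mp hab
  · intro a ha
    obtain ⟨p, -, rfl⟩ := Finset.mem_image.mp ha
    rw [hext]
    exact hc p
  · rw [Finset.card_image_of_injective _ hinj]
    simpa using hl

lemma HeightsClose.excessHeight_le {T T' : Str m n} {I : Window n} {E : ℤ}
    (h : HeightsClose T T' I E) : excessHeight T I ≤ excessHeight T' I + 2 * E := by
  have h1 := abs_le.mp (h I.hi I.lo_le_hi le_rfl)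
  have h2 := abs_le.mp (minOn_close I.lo_le_hi h)
  unfold excessHeight
  omega

/-- If full matchings of `T'` transfer to `T`, then not both can `T'` match and `T` be far from
matching. -/
lemma Transfer.not_far {T T' : Str m n} {S₁ S₂ : Window n} {ε : ℝ} {x : ℕ} (hε : 0 < ε) (hx : 1 ≤ x)
    (h : Transfer T T' S₁ S₂ ⌊ε * x⌋) (hT' : EpsMatch T' ε x S₁ S₂) :
    ¬ FarFromMatch T ε x S₁ S₂ := by
  intro hfar
  obtain ⟨α, β, s, h1, h2⟩ := hT'.exists_fullMatch
  obtain ⟨O, C, h3, h4, h5, h6⟩ := (h.2 α β s h1).exists_nestedMatching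
  have h7 := hfar O C h3 h4 h5
  have h8 : (e0 (S₁.str T) : ℝ) ≤ excessHeight T S₁ := by exact_mod_cast e0_le T S₁
  have h9 : (excessHeight T S₁ : ℝ) ≤ excessHeight T' S₁ + 2 * ⌊ε * x⌋ := by
    exact_mod_cast h.1.excessHeight_le
  have h10 : ((β - α : ℤ) : ℝ) - ⌊ε * x⌋ ≤ O.card := by exact_mod_cast h6
  have h11 := Int.floor_le (ε * x)
  have h12 : 0 < ε * x := by
    have : (1 : ℝ) ≤ x := by exact_mod_cast hx
    positivity
  -- Trimming costs `12 * ε * x`, the comparison of excess heights `2 * ε * x` and the transfer `ε *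
  -- x`: at most `15 * ε * x` in all, less than the `30 * ε * x` of a far string.
  linarith

/-- Even the empty matching is too large, because `e0 ≤ x < 30 * ε * x`. -/
lemma not_far_of_large {T : Str m n} {S₁ S₂ : Window n} {ε : ℝ} {x : ℕ} (hε : 1 / 30 < ε)
    (hx : 1 ≤ x) (hS : S₁.length ≤ x) : ¬ FarFromMatch T ε x S₁ S₂ := by
  intro hfar
  have h1 := hfar ∅ ∅ (by simp) (by simp) ⟨id, by simp [Set.BijOn, Set.InjOn, Set.SurjOn,
    Set.MapsTo], by simp [StrictAntiOn], by simp⟩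
  have h2 : (e0 (S₁.str T) : ℤ) ≤ x := (e0_le T S₁).trans
    ((excessHeight_le_length T S₁).trans (by exact_mod_cast hS))
  have h3 : (e0 (S₁.str T) : ℝ) ≤ x := by exact_mod_cast h2
  have h4 : (1 : ℝ) ≤ x := by exact_mod_cast hx
  simp only [Finset.card_empty, Nat.cast_zero] at h1
  nlinarith

end Slices

/-! ### Decision trees -/

section Trees

variable {m n : ℕ}

/-- The decision tree that queries a list of positions and answers according to the replies. -/
def queryAll : List (Fin n) → (List (Paren m) → Bool) → DecisionTree m n
  | [], k => .answer (k [])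
  | i :: L, k => .query i fun c => queryAll L fun cs => k (c :: cs)

lemma eval_queryAll (L : List (Fin n)) (k : List (Paren m) → Bool) (T : Str m n) :
    (queryAll L k).eval T = k (L.map T) := by
  induction L generalizing k with
  | nil => rfl
  | cons i L ih => simp [queryAll, DecisionTree.eval, ih]

lemma numQueries_queryAll (L : List (Fin n)) (k : List (Paren m) → Bool) (T : Str m n) :
    (queryAll L k).numQueries T = L.length := by
  induction L generalizing k with
  | nil => rfl
  | cons i L ih => simp [queryAll, DecisionTree.numQueries, ih]

lemma probAnswer_map_uniform {Ω : Type} [Fintype Ω] [Nonempty Ω] (tree : Ω → DecisionTree m n)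
    (T : Str m n) (r : Bool) :
    probAnswer ((PMF.uniformOfFintype Ω).map tree) T r =
      prob (fun ω => (tree ω).eval T = r) := by
  classical
  unfold probAnswer
  rw [PMF.map_comp, PMF.map_apply, tsum_fintype, prob_eq, ENNReal.toReal_sum]
  · simp only [Function.comp, PMF.uniformOfFintype_apply]
    rw [Finset.card_filter, Nat.cast_sum, Finset.sum_div]
    refine Finset.sum_congr rfl fun ω _ => ?_
    by_cases h : r = (tree ω).eval T
    · simp [h]
    · simp [h, Ne.symm h]
  · intro ω _
    split_ifs
    · exact PMF.apply_ne_top _ _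
    · exact ENNReal.zero_ne_top

lemma one_sub_le_prob {Ω : Type*} [Fintype Ω] [Nonempty Ω] {P Q : Ω → Prop} {η : ℝ}
    (h : prob (fun ω => ¬ P ω) ≤ η) (hPQ : ∀ ω, P ω → Q ω) : 1 - η ≤ prob Q := by
  have h1 := prob_or_le Q fun ω => ¬ P ω
  have h2 : prob (fun ω : Ω => Q ω ∨ ¬ P ω) = 1 := by
    classical
    rw [prob_eq]
    have : ∀ ω, Q ω ∨ ¬ P ω := fun ω => by
      by_cases hp : P ω
      · exact Or.inl (hPQ ω hp)
      · exact Or.inr hp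
    simp [this]
  linarith

/-- A sampler yields a randomized algorithm. -/
lemma HasSampler.exists_algorithm {x : ℕ} {ε η B : ℝ} (h : HasSampler m n x ⌊ε * x⌋ η B)
    (hε : 0 < ε) (hx : 1 ≤ x) {S₁ S₂ : Window n} (h₁ : S₁.length ≤ x) (h₂ : S₂.length ≤ x) :
    ∃ A : RandomizedAlgorithm m n,
      SolvesSubstringMatching A ε x S₁ S₂ η ∧ QueryComplexityLE A (2 * B) := by
  classical
  obtain ⟨Ω, i1, i2, F, G, Good, hcard, hgood, htrans⟩ := h
  set L : Ω → List (Fin n) := fun ω => (F ω S₁ ∪ G ω S₂).toList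
  set tree : Ω → DecisionTree m n := fun ω => queryAll (L ω) fun cs =>
    decide (∃ T' : Str m n, (L ω).map T' = cs ∧ Good ω T' S₁ S₂ ∧ EpsMatch T' ε x S₁ S₂)
  refine ⟨(PMF.uniformOfFintype Ω).map tree, fun T => ⟨fun hT => ?_, fun hT => ?_⟩, ?_⟩
  · rw [probAnswer_map_uniform]
    refine one_sub_le_prob (hgood T S₁ S₂ h₁ h₂) fun ω hω => ?_
    simp only [tree, eval_queryAll, decide_eq_true_eq]
    exact ⟨T, rfl, hω, hT⟩
  · rw [probAnswer_map_uniform]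
    refine one_sub_le_prob (hgood T S₁ S₂ h₁ h₂) fun ω hω => ?_
    simp only [tree, eval_queryAll, decide_eq_false_iff_not]
    rintro ⟨T', e, hω', hT'⟩
    have heq : ∀ i ∈ F ω S₁ ∪ G ω S₂, T i = T' i := fun i hi =>
      (List.map_inj_left.mp e i (Finset.mem_toList.mpr hi)).symm
    exact (htrans ω T T' S₁ S₂ h₁ h₂ hω hω' (fun i hi => heq i (Finset.mem_union_left _ hi))
      fun i hi => heq i (Finset.mem_union_right _ hi)).not_far hε hx hT' hT
  · intro t ht T
    rw [PMF.support_map] at ht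
    obtain ⟨ω, -, rfl⟩ := ht
    simp only [tree, numQueries_queryAll, L, Finset.length_toList]
    have h3 : ((F ω S₁ ∪ G ω S₂).card : ℝ) ≤ (F ω S₁).card + (G ω S₂).card := by
      exact_mod_cast Finset.card_union_le _ _
    have h4 := (hcard ω S₁ h₁).1
    have h5 := (hcard ω S₂ h₂).2
    linarith

/-- Always accepting is correct for large `ε`. -/
lemma accept_solves {x : ℕ} {ε η B : ℝ} (hε : 1 / 30 < ε) (hx : 1 ≤ x) {S₁ S₂ : Window n}
    (h₁ : S₁.length ≤ x) (hη : 0 ≤ η) (hB : 0 ≤ B) :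
    ∃ A : RandomizedAlgorithm m n,
      SolvesSubstringMatching A ε x S₁ S₂ η ∧ QueryComplexityLE A B := by
  refine ⟨PMF.pure (.answer true), fun T => ⟨fun _ => ?_, fun hT => ?_⟩, fun t ht T => ?_⟩
  · simp only [probAnswer, PMF.pure_map, DecisionTree.eval, PMF.pure_apply, if_true,
      ENNReal.toReal_one]
    linarith
  · exact absurd hT (not_far_of_large hε hx h₁)
  · rw [PMF.support_pure, Set.mem_singleton_iff] at ht
    rw [ht]
    simpa [DecisionTree.numQueries] using hB

end Trees

end SubstringMatching

/-! ### The main theorem -/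

theorem mainTheorem5 (δ : ℝ) (hδ_pos : 0 < δ) (hδ_le : δ ≤ 1 / 2) :
    ∃ (A : ∀ m n : ℕ, ℕ → ℝ → SubstringMatching.Window n → SubstringMatching.Window n →
        SubstringMatching.RandomizedAlgorithm m n) (C : ℝ) (p : ℕ),
      ∀ (m n x : ℕ) (ε : ℝ) (S₁ S₂ : SubstringMatching.Window n),
        1 ≤ x → x ≤ n → 0 < ε → S₁.length ≤ x → S₂.length ≤ x →
        SubstringMatching.SolvesSubstringMatching (A m n x ε S₁ S₂) ε x S₁ S₂
            (1 / (n : ℝ) ^ 2) ∧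
          SubstringMatching.QueryComplexityLE (A m n x ε S₁ S₂)
            (C * (1 + Real.log (n : ℝ)) ^ p *
              ε ^ (4 - 4 * (2 * δ) ^ (1 / Real.logb 2 (3 / 4 : ℝ))) *
              (x : ℝ) ^ (1 / 2 + δ)) := by
  obtain ⟨C, p, hC, h⟩ := SubstringMatching.achievable hδ_pos hδ_le
  have hexp : 4 - 4 * (2 * δ) ^ (1 / Real.logb 2 (3 / 4 : ℝ)) =
      -SubstringMatching.epsExponent δ := by
    unfold SubstringMatching.epsExponent
    ring
  rw [hexp]
  have key : ∀ (m n x : ℕ) (ε : ℝ) (S₁ S₂ : SubstringMatching.Window n),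
      ∃ A : SubstringMatching.RandomizedAlgorithm m n,
        1 ≤ x → x ≤ n → 0 < ε → S₁.length ≤ x → S₂.length ≤ x →
        SubstringMatching.SolvesSubstringMatching A ε x S₁ S₂ (1 / (n : ℝ) ^ 2) ∧
          SubstringMatching.QueryComplexityLE A
            (2 * C * 2 ^ p * (1 + Real.log (n : ℝ)) ^ p *
              ε ^ (-SubstringMatching.epsExponent δ) * (x : ℝ) ^ (1 / 2 + δ)) := by
    intro m n x ε S₁ S₂
    by_cases hyp : 1 ≤ x ∧ x ≤ n ∧ 0 < ε ∧ S₁.length ≤ x ∧ S₂.length ≤ x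
    swap
    · exact ⟨PMF.pure (.answer true), fun a b c d e => absurd ⟨a, b, c, d, e⟩ hyp⟩
    obtain ⟨hx, hxn, hε, h₁, h₂⟩ := hyp
    have hn : (1 : ℝ) ≤ n := by exact_mod_cast hx.trans hxn
    have hlog := Real.log_nonneg hn
    rcases le_or_gt ε (1 / 30) with hε' | hε'
    -- The sampler is used with `Λ = 2 * (1 + log n)`, whence the factor `2 ^ p`; the other factor
    -- `2` counts the two windows.
    · have hη : Real.exp (-(2 * (1 + Real.log n))) ≤ 1 / (n : ℝ) ^ 2 := by
        rw [one_div, Real.exp_neg]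
        refine inv_anti₀ (by positivity) ?_
        calc (n : ℝ) ^ 2 = Real.exp (Real.log n) ^ 2 := by rw [Real.exp_log (by linarith)]
          _ = Real.exp (2 * Real.log n) := by rw [← Real.exp_nat_mul]; push_cast; rfl
          _ ≤ _ := Real.exp_le_exp.mpr (by linarith)
      obtain ⟨A, hA1, hA2⟩ := ((h m n x ε (2 * (1 + Real.log n)) hx hxn hε hε'
        (by linarith)).mono le_rfl hη le_rfl).exists_algorithm hε hx h₁ h₂
      refine ⟨A, fun _ _ _ _ _ => ⟨hA1, fun t ht T => (hA2 t ht T).trans (le_of_eq ?_)⟩⟩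
      rw [mul_pow]
      ring
    · obtain ⟨A, hA⟩ := SubstringMatching.accept_solves (m := m) (n := n) (S₂ := S₂)
        (η := 1 / (n : ℝ) ^ 2) (B := 2 * C * 2 ^ p * (1 + Real.log (n : ℝ)) ^ p *
          ε ^ (-SubstringMatching.epsExponent δ) * (x : ℝ) ^ (1 / 2 + δ)) hε' hx h₁
        (by positivity) (by positivity)
      exact ⟨A, fun _ _ _ _ _ => hA⟩
  choose A hA using key
  exact ⟨A, 2 * C * 2 ^ p, p, fun m n x ε S₁ S₂ a b c d e => hA m n x ε S₁ S₂ a b c d e⟩
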